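/- Throughout, let \(q\ge 1\), let \(\alpha<\beta\) be real, \(\delta:=\beta-\alpha\), let \(A^{*}\) be the conjugate transpose and \(A^{\dagger}\) the Moore--Penrose inverse of a complex matrix \(A\). *Notation.* For a finite sequence \((s_j)_{j=0}^{\kappa}\) of complex \(q\times q\) matrices put (for all indices for which the terms exist) \(a_j:=-\alpha s_j+s_{j+1}\), \(b_j:=\beta s_j-s_{j+1}\), \(c_j:=-\alpha\beta s_j+(\alpha+\beta)s_{j+1}-s_{j+2}\), and \(H_n^{s}:=(s_{j+k})_{j,k=0}^{n}\). Let \(S_n^{s}\) (resp. \(\Sigma_n^{s}\)) be the lower (resp. upper) block triangular block Toeplitz matrix whose \((j,k)\) block, \(0\le j,k\le n\), is \(s_{j-k}\) for \(j\ge k\) (resp. \(s_{k-j}\) for \(k\ge j\)) and \(0\) otherwise. Let \(\langle A\rangle_n:=\operatorname{diag}(A,\dots,A)\) with \(n+1\) blocks. Let \(L_{n+1}^{s}\) be the Schur complement of the upper left block \(s_0\) in \(H_{n+1}^{s}\), i.e. \(L_{n+1}^{s}=(s_{j+k+2}-s_{j+1}s_0^{\dagger}s_{k+1})_{j,k=0}^{n}\).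 The reciprocal sequence is given by \(s_0^{\sharp}:=s_0^{\dagger}\), \(s_j^{\sharp}:=-s_0^{\dagger}\sum_{l=0}^{j-1}s_{j-l}s_l^{\sharp}\). Let \[D_n^{s}:=\langle s_0\rangle_n S_n^{s^\sharp}+\langle I-s_0s_0^{\dagger}\rangle_n,\qquad \mathbb D_n^{s}:=\Sigma_n^{s^\sharp}\langle s_0\rangle_n+\langle I-s_0^{\dagger}s_0\rangle_n,\] and, for a second sequence \(r\) of \(q\times q\) matrices, \[D_n^{s,r}:=\langle s_0\rangle_n S_n^{s^\sharp}S_n^{r}\langle r_0^{\dagger}\rangle_n+\langle I-s_0s_0^{\dagger}r_0r_0^{\dagger}\rangle_n,\qquad \mathbb D_n^{s,r}:=\langle r_0^{\dagger}\rangle_n\Sigma_n^{r}\Sigma_n^{s^\sharp}\langle s_0\rangle_n+\langle I-r_0^{\dagger}r_0s_0^{\dagger}s_0\rangle_n.\] Let \(R_n(z):=(I-zT_n)^{-1}\), where \(T_n\) has the \(q\times q\) blocks \(\delta_{j,k+1}I_q\) (Kronecker delta), \(0\le j,k\le n\). For complex \((n+1)q\times(n+1)q\) matrices write \(A\sim B\)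 if \(B=LAU\) with \(L\) lower and \(U\) upper block triangular (in \(q\times q\) blocks), both with blocks \(I_q\) on the block diagonal. The sequence \((s_j)_{j=0}^{\kappa}\) is called \([\alpha,\beta]\)-non-negative definite if \(H_n^{s}\) and (for \(n\ge1\)) \(H_{n-1}^{c}\) are non-negative Hermitian in the case \(\kappa=2n\), and if \(H_n^{a}\) and \(H_n^{b}\) are non-negative Hermitian in the case \(\kappa=2n+1\). For \(\kappa\ge 1\) the Schur transform \((t_j)_{j=0}^{\kappa-1}\) of \((s_j)_{j=0}^{\kappa}\) is \(t_j:=-a_0s_0^{\dagger}x_ja_0\), where \(x_j:=\sum_{l=0}^{j}b_l h^{\sharp}_{j-l}\) and \(h_0:=-a_0\), \(h_j:=\beta a_{j-1}-a_j\) for \(1\le j\le\kappa-1\). *Proposition.* Let \(n\ge 0\). (a) Let \((s_j)_{j=0}^{2n+2}\) be \([\alpha,\beta]\)-non-negative definite with Schur transform \((t_j)_{j=0}^{2n+1}\), and let \(u_j:=-\alpha t_j+t_{j+1}\), \(0\le j\le 2n\). Then \[H_n^{u}=\delta R_n(\beta)\langle a_0\rangle_n(S_n^{a})^{\dagger}H_n^{c}(\Sigma_n^{a})^{\dagger}\langle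 a_0\rangle_nR_n(\beta)^{*}=\delta R_n(\beta)D_n^{a}H_n^{c}\,\mathbb D_n^{a}R_n(\beta)^{*}.\] In particular, \(\operatorname{rank}H_n^{u}=\operatorname{rank}H_n^{c}\), \(\det H_n^{u}=\delta^{(n+1)q}\det H_n^{c}\), and \(H_n^{u}\sim\delta H_n^{c}\). (b) Under the assumptions of (a), let \(v_j:=\beta t_j-t_{j+1}\), \(0\le j\le 2n\). Then \[H_n^{v}=\delta\langle a_0\rangle_n(S_n^{a})^{\dagger}L_{n+1}^{s}(\Sigma_n^{a})^{\dagger}\langle a_0\rangle_n=\delta D_n^{a,s}D_n^{s}L_{n+1}^{s}\,\mathbb D_n^{s}\,\mathbb D_n^{a,s}.\] In particular, \(\operatorname{rank}H_n^{v}=\operatorname{rank}L_{n+1}^{s}\), \(\det H_n^{v}=\delta^{(n+1)q}\det L_{n+1}^{s}\), and \(H_n^{v}\sim\delta L_{n+1}^{s}\). (c) Let \((s_j)_{j=0}^{2n+3}\) be \([\alpha,\beta]\)-non-negative definite with Schur transform \((t_j)_{j=0}^{2n+2}\), and let \(w_j:=-\alpha\beta t_j+(\alpha+\beta)t_{j+1}-t_{j+2}\),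 \(0\le j\le 2n\). Then \[H_n^{w}=\delta\langle a_0\rangle_n(S_n^{a})^{\dagger}L_{n+1}^{a}(\Sigma_n^{a})^{\dagger}\langle a_0\rangle_n=\delta D_n^{a}L_{n+1}^{a}\,\mathbb D_n^{a}.\] In particular, \(\operatorname{rank}H_n^{w}=\operatorname{rank}L_{n+1}^{a}\), \(\det H_n^{w}=\delta^{(n+1)q}\det L_{n+1}^{a}\), and \(H_n^{w}\sim\delta L_{n+1}^{a}\). -/

import Mathlib

open scoped ComplexOrder

namespace HausdorffMoment

open Matrix

/-! ### Moore–Penrose inverse -/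

/-- `X` satisfies the four Moore–Penrose equations for the complex matrix `A`. -/
structure IsMoorePenrose {m n : Type*} [Fintype m] [Fintype n]
    (A : Matrix m n ℂ) (X : Matrix n m ℂ) : Prop where
  mul_mul_left : A * X * A = A
  mul_mul_right : X * A * X = X
  herm_left : (A * X)ᴴ = A * X
  herm_right : (X * A)ᴴ = X * A

/-- Every complex matrix has a Moore–Penrose inverse. -/
theorem exists_isMoorePenrose {m n : Type*} [Fintype m] [Fintype n]
    (A : Matrix m n ℂ) : ∃ X : Matrix n m ℂ, IsMoorePenrose A X := by
  classical
  have hB : (Aᴴ * A).IsHermitian := isHermitian_conjTranspose_mul_self A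
  set B := Aᴴ * A with hBdef
  let U : Matrix n n ℂ := hB.eigenvectorUnitary
  let d : n → ℂ := fun i => (hB.eigenvalues i : ℂ)
  have hUU : Uᴴ * U = 1 := Unitary.coe_star_mul_self hB.eigenvectorUnitary
  have hBs : B = U * diagonal d * Uᴴ := by
    have h := hB.spectral_theorem
    rw [Unitary.conjStarAlgAut_apply] at h
    exact h
  have hd : ∀ i, star (d i) = d i := fun i => Complex.conj_ofReal _
  let P : Matrix n n ℂ := U * diagonal (fun i => (d i)⁻¹) * Uᴴ
  have key : ∀ e f : n → ℂ, (U * diagonal e * Uᴴ) * (U * diagonal f * Uᴴ)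
      = U * diagonal (fun i => e i * f i) * Uᴴ := by
    intro e f
    calc (U * diagonal e * Uᴴ) * (U * diagonal f * Uᴴ)
        = U * diagonal e * (Uᴴ * U) * diagonal f * Uᴴ := by simp only [Matrix.mul_assoc]
      _ = U * diagonal (fun i => e i * f i) * Uᴴ := by
        rw [hUU, Matrix.mul_one, Matrix.mul_assoc U, diagonal_mul_diagonal]
  have keyH : ∀ e : n → ℂ, (∀ i, star (e i) = e i) →
      (U * diagonal e * Uᴴ)ᴴ = U * diagonal e * Uᴴ := by
    intro e he
    have : star e = e := funext he
    simp only [conjTranspose_mul, conjTranspose_conjTranspose, diagonal_conjTranspose, this,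
      Matrix.mul_assoc]
  have hPH : Pᴴ = P := keyH _ fun i => by rw [star_inv₀, hd]
  have hPB : P * B = U * diagonal (fun i => (d i)⁻¹ * d i) * Uᴴ := by rw [hBs]; exact key _ _
  have hBPB : B * (P * B) = B := by
    rw [hPB, hBs, key]
    congr 3
    funext i
    by_cases h : d i = 0 <;> simp [h]
  have hPBP : P * B * P = P := by
    rw [hPB]
    show _ * (U * diagonal (fun i => (d i)⁻¹) * Uᴴ) = U * diagonal (fun i => (d i)⁻¹) * Uᴴ
    rw [key]
    congr 3
    funext i
    by_cases h : d i = 0 <;> simp [h]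
  have hPBH : (P * B)ᴴ = P * B := by
    rw [hPB]
    exact keyH _ fun i => by rw [star_mul', star_inv₀, hd]
  refine ⟨P * Aᴴ, ?_, ?_, ?_, ?_⟩
  · have h0 : B * (P * B - 1) = 0 := by rw [Matrix.mul_sub, hBPB, Matrix.mul_one, sub_self]
    have h1 : A * (P * B - 1) = 0 := (conjTranspose_mul_self_mul_eq_zero A _).1 h0
    rw [Matrix.mul_sub, Matrix.mul_one, sub_eq_zero] at h1
    simpa only [hBdef, Matrix.mul_assoc] using h1
  · calc P * Aᴴ * A * (P * Aᴴ) = P * B * P * Aᴴ := by simp only [hBdef, Matrix.mul_assoc]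
      _ = P * Aᴴ := by rw [hPBP]
  · simp only [conjTranspose_mul, conjTranspose_conjTranspose, hPH, Matrix.mul_assoc]
  · simpa only [hBdef, Matrix.mul_assoc] using hPBH

/-- The Moore–Penrose inverse is unique. -/
theorem IsMoorePenrose.unique {m n : Type*} [Fintype m] [Fintype n]
    {A : Matrix m n ℂ} {X Y : Matrix n m ℂ} (hX : IsMoorePenrose A X) (hY : IsMoorePenrose A Y) :
    X = Y := by
  have h1 : A * X = A * Y := by
    calc A * X = (A * Y * A) * X := by rw [hY.mul_mul_left]
      _ = (A * Y)ᴴ * (A * X)ᴴ := by rw [hY.herm_left, hX.herm_left]; simp only [Matrix.mul_assoc]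
      _ = ((A * X * A) * Y)ᴴ := by rw [← conjTranspose_mul]; simp only [Matrix.mul_assoc]
      _ = A * Y := by rw [hX.mul_mul_left, hY.herm_left]
  have h2 : X * A = Y * A := by
    calc X * A = X * (A * Y * A) := by rw [hY.mul_mul_left]
      _ = (X * A)ᴴ * (Y * A)ᴴ := by rw [hY.herm_right, hX.herm_right]; simp only [Matrix.mul_assoc]
      _ = (Y * (A * X * A))ᴴ := by rw [← conjTranspose_mul]; simp only [Matrix.mul_assoc]
      _ = Y * A := by rw [hX.mul_mul_left, hY.herm_right]
  calc X = X * A * X := hX.mul_mul_right.symm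
    _ = Y * (A * X) := by rw [h2, Matrix.mul_assoc]
    _ = Y := by rw [h1, ← Matrix.mul_assoc, hY.mul_mul_right]

/-- The Moore–Penrose inverse of a complex matrix. -/
noncomputable def mpInv {m n : Type*} [Fintype m] [Fintype n] (A : Matrix m n ℂ) :
    Matrix n m ℂ :=
  Classical.choose (exists_isMoorePenrose A)

theorem mpInv_spec {m n : Type*} [Fintype m] [Fintype n] (A : Matrix m n ℂ) :
    IsMoorePenrose A (mpInv A) :=
  Classical.choose_spec (exists_isMoorePenrose A)

/-! ### Sequences of complex `q × q` matrices

A finite sequence `s_0, …, s_κ` is represented by any function on `ℕ` which extends it: every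
object below is built only from terms that the finite sequence has. -/

/-- Complex `q × q` matrices. -/
abbrev Mat (q : ℕ) : Type := Matrix (Fin q) (Fin q) ℂ

/-- Complex `(n+1)q × (n+1)q` matrices, arranged in `q × q` blocks indexed by `0, …, n`. -/
abbrev BMat (n q : ℕ) : Type := Matrix (Fin (n + 1) × Fin q) (Fin (n + 1) × Fin q) ℂ

/-- The block matrix with `q × q` blocks `f j k`, `0 ≤ j, k ≤ n`. -/
def blockMat (n : ℕ) {q : ℕ} (f : ℕ → ℕ → Mat q) : BMat n q :=
  Matrix.of fun x y => f x.1 y.1 x.2 y.2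

/-- The block diagonal matrix `diag(A, …, A)` with `n + 1` blocks. -/
def repDiag (n : ℕ) {q : ℕ} (A : Mat q) : BMat n q :=
  blockMat n fun j k => if j = k then A else 0

/-- The lower block triangular Toeplitz matrix of `s_0, …, s_n`. -/
def toepL (n : ℕ) {q : ℕ} (s : ℕ → Mat q) : BMat n q :=
  blockMat n fun j k => if k ≤ j then s (j - k) else 0

/-- The upper block triangular Toeplitz matrix of `s_0, …, s_n`. -/
def toepU (n : ℕ) {q : ℕ} (s : ℕ → Mat q) : BMat n q :=
  blockMat n fun j k => if j ≤ k then s (k - j) else 0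

/-- The block Hankel matrix `H_n = (s_{j+k})_{j,k=0}^n`. -/
def hankel (n : ℕ) {q : ℕ} (s : ℕ → Mat q) : BMat n q :=
  blockMat n fun j k => s (j + k)

/-- The Schur complement `D - C A⁺ B` of `A` in the block matrix `(A B; C D)`. -/
noncomputable def schurCompl {m n k l : Type*} [Fintype m] [Fintype n]
    (A : Matrix m n ℂ) (B : Matrix m l ℂ) (C : Matrix k n ℂ) (D : Matrix k l ℂ) :
    Matrix k l ℂ :=
  D - C * mpInv A * B

/-- `L_{n+1}`: the Schur complement of the upper left `q × q` block `s_0` in `H_{n+1}`. -/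
noncomputable def schurHankelSucc (n : ℕ) {q : ℕ} (s : ℕ → Mat q) : BMat n q :=
  schurCompl
    ((hankel (n + 1) s).submatrix (fun a : Fin q => (0, a)) (fun b : Fin q => (0, b)))
    ((hankel (n + 1) s).submatrix (fun a : Fin q => (0, a))
      (fun y : Fin (n + 1) × Fin q => (y.1.succ, y.2)))
    ((hankel (n + 1) s).submatrix (fun x : Fin (n + 1) × Fin q => (x.1.succ, x.2))
      (fun b : Fin q => (0, b)))
    ((hankel (n + 1) s).submatrix (fun x : Fin (n + 1) × Fin q => (x.1.succ, x.2))
      (fun y : Fin (n + 1) × Fin q => (y.1.succ, y.2)))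

/-! ### Sequences associated with the interval `[α, β]` -/

/-- `a_j = -α s_j + s_{j+1}`. -/
noncomputable def seqA (α : ℝ) {q : ℕ} (s : ℕ → Mat q) : ℕ → Mat q :=
  fun j => -((α : ℂ) • s j) + s (j + 1)

/-- `b_j = β s_j - s_{j+1}`. -/
noncomputable def seqB (β : ℝ) {q : ℕ} (s : ℕ → Mat q) : ℕ → Mat q :=
  fun j => (β : ℂ) • s j - s (j + 1)

/-- `c_j = -α β s_j + (α + β) s_{j+1} - s_{j+2}`. -/
noncomputable def seqAB (α β : ℝ) {q : ℕ} (s : ℕ → Mat q) : ℕ → Mat q :=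
  fun j => -(((α : ℂ) * (β : ℂ)) • s j) + ((α : ℂ) + (β : ℂ)) • s (j + 1) - s (j + 2)

/-- The sequence `s_0, …, s_κ` is `[α, β]`-non-negative definite: `H_n^s` and, if `n ≥ 1`, the
matrix `H_{n-1}^c` are non-negative Hermitian in the case `κ = 2n`, and `H_n^a` and `H_n^b` are
non-negative Hermitian in the case `κ = 2n + 1`. -/
def IsNonnegDef (α β : ℝ) (κ : ℕ) {q : ℕ} (s : ℕ → Mat q) : Prop :=
  (∀ n, κ = 2 * n → (hankel n s).PosSemidef) ∧
  (∀ n, κ = 2 * (n + 1) → (hankel n (seqAB α β s)).PosSemidef) ∧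
  (∀ n, κ = 2 * n + 1 →
    (hankel n (seqA α s)).PosSemidef ∧ (hankel n (seqB β s)).PosSemidef)

/-! ### The Schur transform -/

/-- The reciprocal sequence: `s_0^♯ = s_0⁺` and `s_j^♯ = -s_0⁺ ∑_{l=0}^{j-1} s_{j-l} s_l^♯`. -/
noncomputable def recip {q : ℕ} (s : ℕ → Mat q) : ℕ → Mat q
  | 0 => mpInv (s 0)
  | j + 1 => -(mpInv (s 0) * ∑ l : Fin (j + 1), s (j + 1 - l) * recip s l)
  decreasing_by exact l.2

/-- The Cauchy product of two sequences. -/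
noncomputable def cauchyProd {q : ℕ} (s t : ℕ → Mat q) : ℕ → Mat q :=
  fun j => ∑ l ∈ Finset.range (j + 1), s l * t (j - l)

/-- The sequence `-s_0, b_0, b_1, b_2, …` with `b_j = β s_j - s_{j+1}`. -/
noncomputable def modB (β : ℝ) {q : ℕ} (s : ℕ → Mat q) : ℕ → Mat q
  | 0 => -s 0
  | j + 1 => seqB β s j

/-- The Schur transform of `s_0, …, s_κ`, `κ ≥ 1`: the sequence `t_j = -a_0 s_0⁺ x_j a_0`,
`0 ≤ j ≤ κ - 1`, where `x` is the Cauchy product of `b` and the reciprocal of `modB β a`. -/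
noncomputable def schurTransform (α β : ℝ) {q : ℕ} (s : ℕ → Mat q) : ℕ → Mat q :=
  fun j => -(seqA α s 0 * mpInv (s 0) *
    cauchyProd (seqB β s) (recip (modB β (seqA α s))) j * seqA α s 0)

/-! ### The block triangular factors and equivalence -/

/-- `T_n`: the block shift with `q × q` blocks `δ_{j,k+1} I_q`. -/
def shiftT (n q : ℕ) : BMat n q :=
  blockMat n fun j k => if j = k + 1 then 1 else 0

/-- `R_n(z) = (I - z T_n)⁻¹`. -/
noncomputable def resolv (n q : ℕ) (z : ℂ) : BMat n q :=
  (1 - z • shiftT n q)⁻¹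

/-- The lower factor `D_n^s = ⟨s_0⟩ S_n^{s^♯} + ⟨I - s_0 s_0⁺⟩`. -/
noncomputable def facL (n : ℕ) {q : ℕ} (s : ℕ → Mat q) : BMat n q :=
  repDiag n (s 0) * toepL n (recip s) + repDiag n (1 - s 0 * mpInv (s 0))

/-- The upper factor, with the upper Toeplitz matrix of the reciprocal sequence on the left:
`D'_n^s = S'_n^{s^♯} ⟨s_0⟩ + ⟨I - s_0⁺ s_0⟩`. -/
noncomputable def facU (n : ℕ) {q : ℕ} (s : ℕ → Mat q) : BMat n q :=
  toepU n (recip s) * repDiag n (s 0) + repDiag n (1 - mpInv (s 0) * s 0)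

/-- The lower factor `D_n^{s,t} = ⟨s_0⟩ S_n^{s^♯} S_n^t ⟨t_0⁺⟩ + ⟨I - s_0 s_0⁺ t_0 t_0⁺⟩`. -/
noncomputable def facL₂ (n : ℕ) {q : ℕ} (s t : ℕ → Mat q) : BMat n q :=
  repDiag n (s 0) * toepL n (recip s) * toepL n t * repDiag n (mpInv (t 0)) +
    repDiag n (1 - s 0 * mpInv (s 0) * t 0 * mpInv (t 0))

/-- The upper factor `D'_n^{s,t} = ⟨t_0⁺⟩ S'_n^t S'_n^{s^♯} ⟨s_0⟩ + ⟨I - t_0⁺ t_0 s_0⁺ s_0⟩`. -/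
noncomputable def facU₂ (n : ℕ) {q : ℕ} (s t : ℕ → Mat q) : BMat n q :=
  repDiag n (mpInv (t 0)) * toepU n t * toepU n (recip s) * repDiag n (s 0) +
    repDiag n (1 - mpInv (t 0) * t 0 * mpInv (s 0) * s 0)

/-- Lower block triangular with identity matrices on the block diagonal. -/
def IsUnitLower {n q : ℕ} (M : BMat n q) : Prop :=
  ∀ j k : Fin (n + 1), ∀ a b : Fin q,
    (j < k → M (j, a) (k, b) = 0) ∧ (j = k → M (j, a) (k, b) = (1 : Mat q) a b)

/-- Upper block triangular with identity matrices on the block diagonal. -/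
def IsUnitUpper {n q : ℕ} (M : BMat n q) : Prop :=
  ∀ j k : Fin (n + 1), ∀ a b : Fin q,
    (k < j → M (j, a) (k, b) = 0) ∧ (j = k → M (j, a) (k, b) = (1 : Mat q) a b)

/-- Block LDU equivalence: `B = L A U` with unit lower and upper block triangular `L`, `U`. -/
def LDUEquiv {n q : ℕ} (A B : BMat n q) : Prop :=
  ∃ L U : BMat n q, IsUnitLower L ∧ IsUnitUpper U ∧ B = L * A * U

end HausdorffMoment

/-!
Everything is read off from generating functions. Write `s(z) = ∑ s_j z^j`, and similarly `a(z)`,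
`b(z)`, `t(z)`, for power series with matrix coefficients in a central variable `z`.

*Domination.* Non-negative definiteness forces all `s_j` to be Hermitian with
`ker s_0 ⊆ ker s_j` (`IsNonnegDef.isHermitian_and_mulVec_eq_zero`), and it passes from `s` to `a`
(`IsNonnegDef.isNonnegDef_seqA`), so the same holds for `a`. Hence `a(z)` lives in the corner ring
of the orthogonal projection `Q = a_0 a_0⁺`, and its reciprocal series `a^♯(z)` is its two-sided
inverse there: `a a^♯ = a^♯ a = Q` (`Dominated.mk_mul_mk_recip`, `Dominated.mk_recip_mul_mk`). In
particular `S_n^{a^♯}` is the Moore–Penrose inverse of `S_n^a`. Hermiticity and domination are the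
only consequences of non-negativity that are used. Since every object involves only finitely many
terms, `s` may be continued geometrically (`geomExtend`), so that domination holds for all indices
of both `s` and `a`.

*The Schur transform.* In these terms its definition becomes
`(1 - αz)(1 - βz) t(z) = δ a_0 a^♯(z) a_0 - (1 - βz) a_0 s_0⁺ a_0` (`schur_transform_eq`), from which
similar closed forms for the series of `u`, `v` and `w` follow.

*Hankel matrices.* The infinite block Hankel matrix of `f` has the generating function
`(z f(z) - w f(w)) / (z - w)` in two commuting variables. Its Schur complement has a similar
description, and block triangular Toeplitz factors on the left and right are power series in `z`
and in `w`. The three matrix factorizations thus become identities between power series in two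
variables, which can be checked after multiplication by `z - w` and further regular factors
(`hankel_seqA_identity`, `hankel_seqB_identity`, `hankel_seqAB_identity`).

*The unit triangular factors.* The middle matrices are Hermitian with blocks whose ranges lie in
that of `Q`, so that `⟨a_0⟩ S_n^{a^♯}` may be replaced by `D_n^a`; for `L_{n+1}^s` this range
condition is `Dominated.seqA_proj_mul_schur`. The new factors are Toeplitz matrices of power series
with constant coefficient `1`, hence unit triangular, and the upper ones are the conjugate
transposes of the lower ones. Rank, determinant and equivalence follow
(`congruence_serToepL`).
-/

namespace HausdorffMoment

open Matrix PowerSeries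

/-! ### Identities over a central ground ring -/

section CentralScalars

/-! The ring `E` stands for matrix power series in two variables and `Λ` for its center. The letter
`X` denotes the reciprocal of the series `A`, `Q` the common value of `A * X` and `X * A`, and `σ`
the Moore–Penrose inverse of `s₀`; a primed series is the same one in the other variable
`w`, except that `a₀'` is the Moore–Penrose inverse of `a₀`. -/

variable {Λ E : Type*} [CommRing Λ] [Ring E] [Algebra Λ E]

/-- Closed form of the Schur transform `T`, obtained by eliminating the series `B`. -/
theorem schur_transform_eq {z α β δ : Λ} {A B T X s₀ σ a₀ Q : E}
    (hAB : (1 - β * z) • A + (1 - α * z) • B = δ • s₀)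
    (hT : (1 - β * z) • T = a₀ * σ * B * X * a₀) (hAX : A * X = Q) (hQ : Q * a₀ = a₀)
    (hs : a₀ * σ * s₀ = a₀) :
    (1 - α * z) • (1 - β * z) • T = δ • (a₀ * X * a₀) - (1 - β * z) • (a₀ * σ * a₀) := by
  have e1 : a₀ * σ * A * X * a₀ = a₀ * σ * a₀ := by rw [mul_assoc _ A, hAX, mul_assoc, hQ]
  have e2 : a₀ * σ * s₀ * X * a₀ = a₀ * X * a₀ := by rw [hs]
  have h := congrArg (fun y => a₀ * σ * y * X * a₀) hAB
  simp only [mul_add, add_mul, mul_smul_comm, smul_mul_assoc, e1, e2] at h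
  rw [hT]
  linear_combination (norm := module) h

theorem schur_transform_seqA_eq {z α β δ : Λ} {T U X σ a₀ t₀ : E}
    (hT : (1 - α * z) • (1 - β * z) • T = δ • (a₀ * X * a₀) - (1 - β * z) • (a₀ * σ * a₀))
    (ht : t₀ = δ • a₀ - a₀ * σ * a₀) (hU : z • U = (1 - α * z) • T - t₀) :
    (1 - β * z) • z • U = δ • (a₀ * X * a₀ - (1 - β * z) • a₀) := by
  rw [hU, ht]
  linear_combination (norm := module) hT

theorem schur_transform_seqB_eq {z α β δ : Λ} {T V X σ a₀ t₀ : E} (hδ : δ = β - α)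
    (hT : (1 - α * z) • (1 - β * z) • T = δ • (a₀ * X * a₀) - (1 - β * z) • (a₀ * σ * a₀))
    (ht : t₀ = δ • a₀ - a₀ * σ * a₀) (hV : z • V = t₀ - (1 - β * z) • T) :
    (1 - α * z) • z • V =
      δ • ((1 - α * z) • a₀ - z • (a₀ * σ * a₀) - a₀ * X * a₀) := by
  rw [hV, ht]
  subst hδ
  linear_combination (norm := module) (-1 : Λ) • hT

theorem schur_transform_seqAB_eq {z β δ : Λ} {U W X a₀ u₀ : E}
    (hU : (1 - β * z) • z • U = δ • (a₀ * X * a₀ - (1 - β * z) • a₀))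
    (hW : z • W = u₀ - (1 - β * z) • U) :
    z • z • W = z • u₀ - δ • (a₀ * X * a₀ - (1 - β * z) • a₀) := by
  rw [hW]
  linear_combination (norm := module) (-1 : Λ) • hU

/-- The factorization of the Hankel matrix of `u`, multiplied by `z - w`, where `HU` and `HC` are
the Hankel generating functions of `u` and `c`. -/
theorem hankel_seqA_identity {z w β δ : Λ} {A A' X X' C C' U U' HU HC a₀ Q : E}
    (hU : (1 - β * z) • z • U = δ • (a₀ * X * a₀ - (1 - β * z) • a₀))
    (hU' : (1 - β * w) • w • U' = δ • (a₀ * X' * a₀ - (1 - β * w) • a₀))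
    (hC : z • C = a₀ - (1 - β * z) • A) (hC' : w • C' = a₀ - (1 - β * w) • A')
    (hHU : (z - w) • HU = z • U - w • U') (hHC : (z - w) • HC = z • C - w • C')
    (hXA : X * A = Q) (hAX' : A' * X' = Q) (ha₀Q : a₀ * Q = a₀) (hQa₀ : Q * a₀ = a₀) :
    (z - w) • (1 - β * z) • (1 - β * w) • HU = (z - w) • δ • (a₀ * X * HC * X' * a₀) := by
  have e1 : a₀ * X * A * X' * a₀ = a₀ * X' * a₀ := by rw [mul_assoc a₀, hXA, ha₀Q]
  have e2 : a₀ * X * A' * X' * a₀ = a₀ * X * a₀ := by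
    rw [mul_assoc _ A', hAX', mul_assoc _ Q, hQa₀]
  rw [hC, hC'] at hHC
  have h := congrArg (fun y => a₀ * X * y * X' * a₀) hHC
  simp only [mul_sub, sub_mul, mul_smul_comm, smul_mul_assoc, e1, e2] at h
  linear_combination (norm := module) ((1 - β * z) * (1 - β * w)) • hHU + (1 - β * w) • hU
    - (1 - β * z) • hU' - δ • h

/-- The factorization of the Hankel matrix of `v`, multiplied by `z - w` and by `1 - α z` and
`1 - α w`. Here `S` is the shifted series `s_1 + s_2 z + ⋯`, in terms of which the Schur complement
`L` is expressed. -/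
theorem hankel_seqB_identity {z w α δ : Λ}
    {A A' X X' S S' V V' HV L s₀ σ a₀ Q P : E}
    (hV : (1 - α * z) • z • V =
      δ • ((1 - α * z) • a₀ - z • (a₀ * σ * a₀) - a₀ * X * a₀))
    (hV' : (1 - α * w) • w • V' =
      δ • ((1 - α * w) • a₀ - w • (a₀ * σ * a₀) - a₀ * X' * a₀))
    (hS : A = (1 - α * z) • S - α • s₀) (hS' : A' = (1 - α * w) • S' - α • s₀)
    (hHV : (z - w) • HV = z • V - w • V')
    (hL : (z - w) • L = S - S' - (z - w) • (S * σ * S'))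
    (hP : s₀ * σ = P) (hP' : σ * s₀ = P) (hAP : A * P = A) (hPA : P * A' = A')
    (hPs : P * s₀ = s₀)
    (hXA : X * A = Q) (hAX' : A' * X' = Q) (ha₀Q : a₀ * Q = a₀) (hQa₀ : Q * a₀ = a₀) :
    (z - w) • (1 - α * z) • (1 - α * w) • HV = (z - w) • δ • ((1 - α * z) • (1 - α * w) •
      (a₀ * X * L * X' * a₀)) := by
  have e1 : a₀ * X * A * X' * a₀ = a₀ * X' * a₀ := by rw [mul_assoc a₀, hXA, ha₀Q]
  have e2 : a₀ * X * A' * X' * a₀ = a₀ * X * a₀ := by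
    rw [mul_assoc _ A', hAX', mul_assoc _ Q, hQa₀]
  have e3 : a₀ * X * (A * σ * A') * X' * a₀ = a₀ * σ * a₀ := by
    rw [show a₀ * X * (A * σ * A') * X' * a₀ = a₀ * (X * A) * σ * ((A' * X') * a₀) by
      simp only [mul_assoc], hXA, hAX', ha₀Q, hQa₀]
  have hp : (1 - α * z) • S = A + α • s₀ := by rw [hS]; abel
  have hp' : (1 - α * w) • S' = A' + α • s₀ := by rw [hS']; abel
  have hprod : (1 - α * z) • (1 - α * w) • (S * σ * S') =
      A * σ * A' + α • A + α • A' + (α * α) • s₀ := by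
    have : (1 - α * z) • (1 - α * w) • (S * σ * S') =
        ((1 - α * z) • S) * σ * ((1 - α * w) • S') := by
      simp only [mul_smul_comm, smul_mul_assoc]
      module
    rw [this, hp, hp']
    simp only [mul_add, add_mul, mul_smul_comm, smul_mul_assoc, hP, mul_assoc A σ s₀, hP', hAP,
      hPA, hPs]
    module
  have key : (z - w) • (1 - α * z) • (1 - α * w) • L = (1 - α * z) • A - (1 - α * w) • A'
      - (z - w) • (A * σ * A') := by
    linear_combination (norm := module) ((1 - α * z) * (1 - α * w)) • hL
      + (1 - α * w) • hp - (1 - α * z) • hp' - (z - w) • hprod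
  have h := congrArg (fun y => a₀ * X * y * X' * a₀) key
  simp only [mul_sub, sub_mul, mul_smul_comm, smul_mul_assoc, e1, e2, e3] at h
  linear_combination (norm := module) ((1 - α * z) * (1 - α * w)) • hHV + (1 - α * w) • hV
    - (1 - α * z) • hV' - δ • h

/-- The factorization of the Hankel matrix of `w`, multiplied by `z - w`, `z` and `w`. Here `A₁` is
the shifted series `a_1 + a_2 z + ⋯`, in terms of which the Schur complement `L` is expressed. -/
theorem hankel_seqAB_identity {z w β δ : Λ}
    {A A' A₁ A₁' X X' W W' HW L a₀ a₀' u₀ Q : E}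
    (hW : z • z • W = z • u₀ - δ • (a₀ * X * a₀ - (1 - β * z) • a₀))
    (hW' : w • w • W' = w • u₀ - δ • (a₀ * X' * a₀ - (1 - β * w) • a₀))
    (hA : z • A₁ = A - a₀) (hA' : w • A₁' = A' - a₀)
    (hHW : (z - w) • HW = z • W - w • W')
    (hL : (z - w) • L = A₁ - A₁' - (z - w) • (A₁ * a₀' * A₁'))
    (hQ : a₀ * a₀' = Q) (hQ' : a₀' * a₀ = Q) (hAQ : A * Q = A) (hQA : Q * A' = A')
    (hXA : X * A = Q) (hAX' : A' * X' = Q) (ha₀Q : a₀ * Q = a₀) (hQa₀ : Q * a₀ = a₀) :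
    (z - w) • z • w • HW = (z - w) • z • w • δ • (a₀ * X * L * X' * a₀) := by
  have e1 : a₀ * X * A * X' * a₀ = a₀ * X' * a₀ := by rw [mul_assoc a₀, hXA, ha₀Q]
  have e2 : a₀ * X * A' * X' * a₀ = a₀ * X * a₀ := by
    rw [mul_assoc _ A', hAX', mul_assoc _ Q, hQa₀]
  have e3 : a₀ * X * (A * a₀' * A') * X' * a₀ = a₀ := by
    rw [show a₀ * X * (A * a₀' * A') * X' * a₀ = a₀ * (X * A) * a₀' * ((A' * X') * a₀) by
      simp only [mul_assoc], hXA, hAX', ha₀Q, hQa₀, hQ, hQa₀]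
  have hprod : z • w • (A₁ * a₀' * A₁') = A * a₀' * A' - A - A' + a₀ := by
    have : z • w • (A₁ * a₀' * A₁') = (z • A₁) * a₀' * (w • A₁') := by
      simp only [mul_smul_comm, smul_mul_assoc]
      module
    rw [this, hA, hA']
    simp only [mul_sub, sub_mul, hQ, mul_assoc A a₀' a₀, hQ', hAQ, hQA, hQa₀]
    abel
  have key : (z - w) • z • w • L = z • A - w • A' - (z - w) • (A * a₀' * A') := by
    linear_combination (norm := module) (z * w) • hL + w • hA - z • hA' - (z - w) • hprod
  have h := congrArg (fun y => a₀ * X * y * X' * a₀) key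
  simp only [mul_sub, sub_mul, mul_smul_comm, smul_mul_assoc, e1, e2, e3] at h
  linear_combination (norm := module) (z * w) • hHW + w • hW - z • hW' - δ • h

end CentralScalars

/-! ### Moore–Penrose inverses and reciprocal series -/

section MoorePenrose
variable {q : ℕ} {M : Mat q}

theorem IsMoorePenrose.mpInv_eq {m n : Type*} [Fintype m] [Fintype n]
    {A : Matrix m n ℂ} {X : Matrix n m ℂ} (h : IsMoorePenrose A X) : mpInv A = X :=
  (mpInv_spec A).unique h

theorem mpInv_neg {m n : Type*} [Fintype m] [Fintype n] (A : Matrix m n ℂ) :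
    mpInv (-A) = -mpInv A := by
  obtain ⟨h₁, h₂, h₃, h₄⟩ := mpInv_spec A
  apply IsMoorePenrose.mpInv_eq
  constructor <;> simp only [Matrix.neg_mul, Matrix.mul_neg, neg_neg, h₁, h₂, h₃, h₄]

theorem mpInv_conjTranspose {m n : Type*} [Fintype m] [Fintype n] (A : Matrix m n ℂ) :
    mpInv Aᴴ = (mpInv A)ᴴ := by
  obtain ⟨h₁, h₂, h₃, h₄⟩ := mpInv_spec A
  apply IsMoorePenrose.mpInv_eq
  constructor
  · rw [← conjTranspose_mul, ← conjTranspose_mul, ← Matrix.mul_assoc, h₁]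
  · rw [← conjTranspose_mul, ← conjTranspose_mul, ← Matrix.mul_assoc, h₂]
  · rw [← conjTranspose_mul, h₄, h₄]
  · rw [← conjTranspose_mul, h₃, h₃]

theorem conjTranspose_mpInv (hM : Mᴴ = M) : (mpInv M)ᴴ = mpInv M := by
  rw [← mpInv_conjTranspose, hM]

theorem mul_mpInv_comm (hM : Mᴴ = M) : M * mpInv M = mpInv M * M := by
  have h := (mpInv_spec M).herm_left
  rwa [conjTranspose_mul, conjTranspose_mpInv hM, hM, eq_comm] at h

end MoorePenrose

/-- A sequence of Hermitian matrices all of whose ranges lie in the range of the first term;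
by hermiticity, all kernels then contain the kernel of the first term. -/
structure Dominated {q : ℕ} (f : ℕ → Mat q) : Prop where
  herm : ∀ j, (f j)ᴴ = f j
  proj_mul : ∀ j, f 0 * mpInv (f 0) * f j = f j

/-- The coefficientwise conjugate transpose of a matrix power series. -/
noncomputable def serStar {q : ℕ} (F : (Mat q)⟦X⟧) : (Mat q)⟦X⟧ :=
  PowerSeries.mk fun j => (coeff j F)ᴴ

section Star
variable {q : ℕ}

theorem serStar_mul (F G : (Mat q)⟦X⟧) : serStar (F * G) = serStar G * serStar F := by
  ext1 j
  simp only [serStar, coeff_mk, coeff_mul, conjTranspose_sum, conjTranspose_mul]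
  rw [← Finset.Nat.sum_antidiagonal_swap]
  rfl

theorem serStar_C (M : Mat q) : serStar (C M) = C Mᴴ := by
  ext1 j
  simp only [serStar, coeff_mk, coeff_C]
  split_ifs <;> simp

theorem serStar_mk_of_herm {f : ℕ → Mat q} (hf : ∀ j, (f j)ᴴ = f j) :
    serStar (PowerSeries.mk f) = PowerSeries.mk f := by
  ext1 j
  simp [serStar, hf]

end Star

theorem mk_cauchyProd {q : ℕ} (f g : ℕ → Mat q) :
    PowerSeries.mk (cauchyProd f g) = PowerSeries.mk f * PowerSeries.mk g := by
  ext1 j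
  simp only [coeff_mul, coeff_mk, cauchyProd]
  exact (Finset.Nat.sum_antidiagonal_eq_sum_range_succ_mk (fun x => f x.1 * g x.2) j).symm

theorem recip_zero {q : ℕ} (f : ℕ → Mat q) : recip f 0 = mpInv (f 0) := by
  rw [recip]

theorem recip_succ {q : ℕ} (f : ℕ → Mat q) (j : ℕ) : recip f (j + 1) =
    -(mpInv (f 0) * ∑ l ∈ Finset.range (j + 1), f (j + 1 - l) * recip f l) := by
  rw [recip, Finset.sum_range fun l => f (j + 1 - l) * recip f l]

theorem recip_mul_proj {q : ℕ} (f : ℕ → Mat q) (j : ℕ) : recip f j * (f 0 * mpInv (f 0)) = recip f j := by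
  induction j using Nat.strong_induction_on with
  | _ j ih =>
    cases j with
    | zero => rw [recip_zero, ← mul_assoc, (mpInv_spec (f 0)).mul_mul_right]
    | succ j =>
      rw [recip_succ, neg_mul, mul_assoc, Finset.sum_mul]
      congr 2
      refine Finset.sum_congr rfl fun l hl => ?_
      rw [mul_assoc, ih l (Finset.mem_range.1 hl)]

theorem mk_recip_mul_C_proj {q : ℕ} (f : ℕ → Mat q) :
    PowerSeries.mk (recip f) * C (f 0 * mpInv (f 0)) = PowerSeries.mk (recip f) := by
  ext1 j
  rw [coeff_mul_C, coeff_mk, recip_mul_proj]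

namespace Dominated
variable {q : ℕ} {f : ℕ → Mat q} (hf : Dominated f)
include hf

theorem proj_eq : f 0 * mpInv (f 0) = mpInv (f 0) * f 0 := mul_mpInv_comm (hf.herm 0)

theorem mul_proj (j : ℕ) : f j * (f 0 * mpInv (f 0)) = f j := by
  have h := congrArg conjTranspose (hf.proj_mul j)
  rwa [conjTranspose_mul, (mpInv_spec (f 0)).herm_left, hf.herm] at h

theorem proj_mul_mpInv : f 0 * mpInv (f 0) * mpInv (f 0) = mpInv (f 0) := by
  rw [hf.proj_eq, (mpInv_spec (f 0)).mul_mul_right]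

theorem proj_mul_recip (j : ℕ) : f 0 * mpInv (f 0) * recip f j = recip f j := by
  cases j with
  | zero => rw [recip_zero, hf.proj_mul_mpInv]
  | succ j => rw [recip_succ, mul_neg, ← mul_assoc, hf.proj_mul_mpInv]

/-- The reciprocal sequence is a right inverse in the corner ring of the projection
`f 0 * mpInv (f 0)`. This needs `f 0 * mpInv (f 0)` to fix every `f j`. -/
theorem mk_mul_mk_recip :
    PowerSeries.mk f * PowerSeries.mk (recip f) = C (f 0 * mpInv (f 0)) := by
  ext1 j
  rw [coeff_C, coeff_mul]
  simp only [coeff_mk]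
  rw [← Finset.Nat.sum_antidiagonal_swap,
    Finset.Nat.sum_antidiagonal_eq_sum_range_succ_mk (fun x => f x.swap.1 * recip f x.swap.2)]
  simp only [Prod.swap]
  cases j with
  | zero => simp [recip_zero]
  | succ j =>
    rw [Finset.sum_range_succ, Nat.sub_self, recip_succ, mul_neg, ← mul_assoc, Finset.mul_sum]
    simp only [← mul_assoc, hf.proj_mul]
    simp

theorem C_proj_mul_mk_recip :
    C (f 0 * mpInv (f 0)) * PowerSeries.mk (recip f) = PowerSeries.mk (recip f) := by
  ext1 j
  rw [coeff_C_mul, coeff_mk, hf.proj_mul_recip]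

theorem C_proj_mul_mk : C (f 0 * mpInv (f 0)) * PowerSeries.mk f = PowerSeries.mk f := by
  ext1 j
  rw [coeff_C_mul, coeff_mk, hf.proj_mul]

theorem mk_mul_C_proj : PowerSeries.mk f * C (f 0 * mpInv (f 0)) = PowerSeries.mk f := by
  ext1 j
  rw [coeff_mul_C, coeff_mk, hf.mul_proj]

/-- The reciprocal of a sequence of Hermitian matrices consists of Hermitian matrices, because
one-sided inverses in the corner ring agree. -/
theorem serStar_mk_recip :
    serStar (PowerSeries.mk (recip f)) = PowerSeries.mk (recip f) := by
  -- both series are inverse to `f` in the corner ring of the projection `f 0 * mpInv (f 0)`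
  have h₁ := congrArg serStar hf.mk_mul_mk_recip
  rw [serStar_mul, serStar_C, (mpInv_spec (f 0)).herm_left, serStar_mk_of_herm hf.herm] at h₁
  have h₂ := congrArg serStar hf.C_proj_mul_mk_recip
  rw [serStar_mul, serStar_C, (mpInv_spec (f 0)).herm_left] at h₂
  rw [← h₂, ← hf.mk_mul_mk_recip, ← mul_assoc, h₁, hf.C_proj_mul_mk_recip]

theorem mk_recip_mul_mk :
    PowerSeries.mk (recip f) * PowerSeries.mk f = C (f 0 * mpInv (f 0)) := by
  have h₁ := congrArg serStar hf.mk_mul_mk_recip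
  rwa [serStar_mul, serStar_C, (mpInv_spec (f 0)).herm_left, serStar_mk_of_herm hf.herm,
    hf.serStar_mk_recip] at h₁

theorem recip_herm (j : ℕ) : (recip f j)ᴴ = recip f j := by
  have h := congrArg (coeff j) hf.serStar_mk_recip
  simpa [serStar] using h

end Dominated

/-! ### Block Toeplitz matrices and unit triangular congruence -/

section Blocks
variable {n q : ℕ}

theorem blockMat_mul (f g : ℕ → ℕ → Mat q) : blockMat n f * blockMat n g =
    blockMat n fun j k => ∑ l ∈ Finset.range (n + 1), f j l * g l k := by
  ext ⟨j, a⟩ ⟨k, b⟩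
  simp only [blockMat, Matrix.mul_apply, of_apply, Fintype.sum_prod_type]
  rw [Finset.sum_range, Matrix.sum_apply]
  rfl

theorem blockMat_congr {f g : ℕ → ℕ → Mat q} (h : ∀ j ≤ n, ∀ k ≤ n, f j k = g j k) :
    blockMat n f = blockMat n g := by
  ext ⟨j, a⟩ ⟨k, b⟩
  simp only [blockMat, of_apply]
  rw [h j (by omega) k (by omega)]

theorem blockMat_add (f g : ℕ → ℕ → Mat q) :
    blockMat n f + blockMat n g = blockMat n fun j k => f j k + g j k := rfl

theorem smul_blockMat (c : ℂ) (f : ℕ → ℕ → Mat q) :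
    c • blockMat n f = blockMat n fun j k => c • f j k := rfl

theorem blockMat_conjTranspose (f : ℕ → ℕ → Mat q) :
    (blockMat n f)ᴴ = blockMat n fun j k => (f k j)ᴴ := rfl

theorem toepL_mul_blockMat (f : ℕ → Mat q) (g : ℕ → ℕ → Mat q) :
    toepL n f * blockMat n g =
      blockMat n fun j k => ∑ l ∈ Finset.range (j + 1), f (j - l) * g l k := by
  rw [toepL, blockMat_mul]
  refine blockMat_congr fun j hj k _ => ?_
  rw [← Finset.sum_subset (Finset.range_mono (by omega : j + 1 ≤ n + 1))]
  · refine Finset.sum_congr rfl fun l hl => ?_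
    rw [if_pos (by simpa [Nat.lt_succ_iff] using hl)]
  · intro l _ hl
    rw [if_neg (by simpa [Nat.lt_succ_iff] using hl), zero_mul]

theorem blockMat_mul_toepU (f : ℕ → Mat q) (g : ℕ → ℕ → Mat q) :
    blockMat n g * toepU n f =
      blockMat n fun j k => ∑ l ∈ Finset.range (k + 1), g j l * f (k - l) := by
  rw [toepU, blockMat_mul]
  refine blockMat_congr fun j _ k hk => ?_
  rw [← Finset.sum_subset (Finset.range_mono (by omega : k + 1 ≤ n + 1))]
  · refine Finset.sum_congr rfl fun l hl => ?_
    rw [if_pos (by simpa [Nat.lt_succ_iff] using hl)]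
  · intro l _ hl
    rw [if_neg (by simpa [Nat.lt_succ_iff] using hl), mul_zero]

/-- The lower block triangular Toeplitz matrix of the coefficients of a power series. -/
noncomputable def serToepL (n : ℕ) {q : ℕ} (F : (Mat q)⟦X⟧) : BMat n q :=
  toepL n fun j => coeff j F

theorem serToepL_mk (f : ℕ → Mat q) : serToepL n (PowerSeries.mk f) = toepL n f := by
  simp [serToepL]

theorem serToepL_mul (F G : (Mat q)⟦X⟧) :
    serToepL n (F * G) = serToepL n F * serToepL n G := by
  unfold serToepL
  conv_rhs => rw [toepL.eq_def n fun j => coeff j G]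
  rw [toepL_mul_blockMat, toepL]
  refine blockMat_congr fun j _ k _ => ?_
  split_ifs with h
  · obtain ⟨d, rfl⟩ := Nat.exists_eq_add_of_le h
    rw [add_assoc, Finset.sum_range_add, Finset.sum_eq_zero, zero_add, Nat.add_sub_cancel_left,
      coeff_mul, ← Finset.Nat.sum_antidiagonal_swap,
      Finset.Nat.sum_antidiagonal_eq_sum_range_succ_mk
        (fun x => coeff x.swap.1 F * coeff x.swap.2 G)]
    · refine Finset.sum_congr rfl fun l hl => ?_
      rw [if_pos (by omega), Nat.add_sub_cancel_left, Nat.add_sub_add_left]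
      rfl
    · intro l hl
      rw [if_neg (by simpa using hl), mul_zero]
  · refine (Finset.sum_eq_zero fun l hl => ?_).symm
    rw [Finset.mem_range] at hl
    rw [if_neg (by omega), mul_zero]

theorem serToepL_add (F G : (Mat q)⟦X⟧) :
    serToepL n (F + G) = serToepL n F + serToepL n G := by
  simp only [serToepL, toepL, blockMat_add]
  refine blockMat_congr fun j _ k _ => ?_
  split_ifs <;> simp

theorem serToepL_C (M : Mat q) : serToepL n (C M) = repDiag n M := by
  simp only [serToepL, toepL, repDiag, coeff_C]
  refine blockMat_congr fun j _ k _ => ?_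
  split_ifs <;> first | rfl | omega

theorem repDiag_one : repDiag n (1 : Mat q) = 1 := by
  ext ⟨j, a⟩ ⟨k, b⟩
  simp only [repDiag, blockMat, of_apply, Matrix.one_apply, Prod.mk.injEq, Fin.val_inj]
  by_cases h : j = k <;> simp [h, Matrix.one_apply]

theorem serToepL_one : serToepL n (1 : (Mat q)⟦X⟧) = 1 := by
  rw [← map_one C, serToepL_C, repDiag_one]

theorem repDiag_conjTranspose (M : Mat q) : (repDiag n M)ᴴ = repDiag n Mᴴ := by
  rw [repDiag, blockMat_conjTranspose]
  refine blockMat_congr fun j _ k _ => ?_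
  simp only [eq_comm]
  split_ifs <;> simp

theorem toepL_conjTranspose (f : ℕ → Mat q) :
    (toepL n f)ᴴ = toepU n fun j => (f j)ᴴ := by
  rw [toepL, blockMat_conjTranspose]
  refine blockMat_congr fun j _ k _ => ?_
  split_ifs <;> simp

/-- The leading `(n + 1) × (n + 1)` block matrix of coefficients of a power series in two
commuting variables: the outer variable indexes the block rows, the inner one the columns. -/
noncomputable def coeffMat (n : ℕ) {q : ℕ} (G : (Mat q)⟦X⟧⟦X⟧) : BMat n q :=
  blockMat n fun j k => coeff k (coeff j G)

theorem coeffMat_map_C_mul (F : (Mat q)⟦X⟧) (G : (Mat q)⟦X⟧⟦X⟧) :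
    coeffMat n (PowerSeries.map C F * G) = serToepL n F * coeffMat n G := by
  rw [coeffMat, coeffMat, serToepL, toepL_mul_blockMat]
  refine blockMat_congr fun j _ k _ => ?_
  rw [coeff_mul, ← Finset.Nat.sum_antidiagonal_swap,
      Finset.Nat.sum_antidiagonal_eq_sum_range_succ_mk
        (fun x => coeff x.swap.1 (PowerSeries.map C F) * coeff x.swap.2 G), map_sum]
  simp [coeff_C_mul]

/-- A series in the inner variable acts from the right as an upper block triangular Toeplitz matrix,
written here as the conjugate transpose of a lower one. -/
theorem coeffMat_mul_C (G : (Mat q)⟦X⟧⟦X⟧) (F : (Mat q)⟦X⟧) :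
    coeffMat n (G * C F) = coeffMat n G * (serToepL n (serStar F))ᴴ := by
  rw [coeffMat, coeffMat, serToepL, toepL_conjTranspose, blockMat_mul_toepU]
  refine blockMat_congr fun j _ k _ => ?_
  rw [coeff_mul_C, coeff_mul, Finset.Nat.sum_antidiagonal_eq_sum_range_succ_mk
        (fun x => coeff x.1 (coeff j G) * coeff x.2 F)]
  simp [serStar]

end Blocks

section Triangular
variable {n q : ℕ}

theorem isUnitLower_serToepL {F : (Mat q)⟦X⟧} (hF : coeff 0 F = 1) :
    IsUnitLower (serToepL n F) := by
  intro j k a b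
  simp only [serToepL, toepL, blockMat, of_apply]
  refine ⟨fun h => ?_, fun h => ?_⟩
  · rw [if_neg (by omega)]
    rfl
  · rw [if_pos (by omega), h, Nat.sub_self, hF]

theorem IsUnitLower.conjTranspose {M : BMat n q} (hM : IsUnitLower M) : IsUnitUpper Mᴴ := by
  intro j k a b
  refine ⟨fun h => ?_, fun h => ?_⟩
  · rw [conjTranspose_apply, (hM k j b a).1 h, star_zero]
  · rw [conjTranspose_apply, (hM k j b a).2 h.symm, ← conjTranspose_apply, conjTranspose_one]

theorem IsUnitLower.det {M : BMat n q} (hM : IsUnitLower M) : M.det = 1 := by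
  have hT : M.BlockTriangular fun x => OrderDual.toDual x.1 := by
    rintro ⟨j, a⟩ ⟨k, b⟩ h
    exact (hM j k a b).1 h
  rw [hT.det_fintype]
  refine Finset.prod_eq_one fun k _ => ?_
  have : M.toSquareBlock (fun x => OrderDual.toDual x.1) k = 1 := by
    ext ⟨⟨i, a⟩, hi⟩ ⟨⟨j, b⟩, hj⟩
    have hij : i = j := hi.trans hj.symm
    subst hij
    simp only [toSquareBlock_def, of_apply, (hM i i a b).2 rfl, Matrix.one_apply, Subtype.mk.injEq,
      Prod.mk.injEq, true_and]
  rw [this, det_one]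

/-- Congruence by an invertible lower block triangular Toeplitz matrix with identity diagonal. -/
theorem congruence_serToepL {F : (Mat q)⟦X⟧} (hF : coeff 0 F = 1) {c : ℂ} (hc : c ≠ 0)
    {A B : BMat n q} (h : A = c • (serToepL n F * B * (serToepL n F)ᴴ)) :
    A.rank = B.rank ∧ A.det = c ^ ((n + 1) * q) * B.det ∧ LDUEquiv A (c • B) := by
  have hL := isUnitLower_serToepL (n := n) hF
  have hdet : (serToepL n F).det = 1 := hL.det
  have hdet' : (serToepL n F)ᴴ.det = 1 := by rw [det_conjTranspose, hdet, star_one]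
  refine ⟨?_, ?_, ?_⟩
  · have : c • (serToepL n F * B * (serToepL n F)ᴴ) =
        (c • serToepL n F) * B * (serToepL n F)ᴴ := by simp
    rw [h, this, rank_mul_eq_left_of_isUnit_det, rank_mul_eq_right_of_isUnit_det]
    · rw [det_smul, hdet, mul_one]
      exact (pow_ne_zero _ hc).isUnit
    · rw [hdet']
      exact isUnit_one
  · rw [h, det_smul, det_mul, det_mul, hdet, hdet']
    simp
  · obtain ⟨G, hFG⟩ : ∃ G, F * G = 1 :=
      ⟨_, PowerSeries.mul_invOfUnit F 1 (by simpa using hF)⟩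
    have hG : coeff 0 G = 1 := by
      have := congrArg (coeff 0) hFG
      simpa [coeff_mul, hF] using this
    have h₁ : serToepL n G * serToepL n F = 1 := by
      rw [mul_eq_one_comm, ← serToepL_mul, hFG, serToepL_one]
    have h₂ : (serToepL n F)ᴴ * (serToepL n G)ᴴ = 1 := by
      rw [← conjTranspose_mul, h₁, conjTranspose_one]
    refine ⟨serToepL n G, (serToepL n G)ᴴ, isUnitLower_serToepL hG,
      (isUnitLower_serToepL hG).conjTranspose, ?_⟩
    have : serToepL n G * A * (serToepL n G)ᴴ = c • ((serToepL n G * serToepL n F) * B *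
        ((serToepL n F)ᴴ * (serToepL n G)ᴴ)) := by
      rw [h]
      simp only [Matrix.mul_assoc, Matrix.mul_smul, Matrix.smul_mul]
    rw [this, h₁, h₂, Matrix.one_mul, Matrix.mul_one]

end Triangular

/-! ### The Schur transform as a power series -/

section OneVariable
variable {q : ℕ}

theorem coeff_const_smul {R : Type*} [Ring R] [Algebra ℂ R] (γ : ℂ) (F : R⟦X⟧) (j : ℕ) :
    coeff j (γ • F) = γ • coeff j F := rfl

/-- The sequence `c` is `b` formed from `a`; hence also `w` is `b` formed from `u`. -/
theorem seqAB_eq (α β : ℝ) (s : ℕ → Mat q) : seqAB α β s = seqB β (seqA α s) := by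
  funext j
  simp only [seqAB, seqA, seqB]
  module

theorem X_mul_mk_seqA (α : ℝ) (s : ℕ → Mat q) : X * PowerSeries.mk (seqA α s) =
    PowerSeries.mk s - (α : ℂ) • (X * PowerSeries.mk s) - C (s 0) := by
  ext1 j
  cases j with
  | zero =>
    simp only [map_sub, coeff_mk, coeff_const_smul, coeff_zero_X_mul, coeff_C, if_true, smul_zero,
      sub_zero, sub_self]
  | succ j =>
    simp only [coeff_succ_X_mul, map_sub, coeff_mk, coeff_const_smul, coeff_C, seqA]
    simp
    abel

theorem X_mul_mk_seqB (β : ℝ) (s : ℕ → Mat q) : X * PowerSeries.mk (seqB β s) =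
    C (s 0) - (PowerSeries.mk s - (β : ℂ) • (X * PowerSeries.mk s)) := by
  ext1 j
  cases j with
  | zero =>
    simp only [map_sub, coeff_mk, coeff_const_smul, coeff_zero_X_mul, coeff_C, if_true, smul_zero,
      sub_zero, sub_self]
  | succ j =>
    simp only [coeff_succ_X_mul, map_sub, coeff_mk, coeff_const_smul, coeff_C, seqB]
    simp

theorem mk_seqA_add_mk_seqB (α β : ℝ) (s : ℕ → Mat q) :
    (PowerSeries.mk (seqA α s) - (β : ℂ) • (X * PowerSeries.mk (seqA α s))) +
      (PowerSeries.mk (seqB β s) - (α : ℂ) • (X * PowerSeries.mk (seqB β s))) =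
      ((β : ℂ) - α) • C (s 0) := by
  ext1 j
  cases j with
  | zero =>
    simp only [map_add, map_sub, coeff_mk, coeff_const_smul, coeff_zero_X_mul, coeff_C, seqA, seqB,
      if_true]
    module
  | succ j =>
    simp only [map_add, map_sub, coeff_mk, coeff_const_smul, coeff_succ_X_mul, coeff_C, seqA, seqB,
      Nat.succ_ne_zero, if_false]
    module

theorem X_mul_mk_shift (f : ℕ → Mat q) :
    X * PowerSeries.mk (fun j => f (j + 1)) = PowerSeries.mk f - C (f 0) := by
  ext1 j
  cases j with
  | zero => simp
  | succ j => simp [coeff_succ_X_mul]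

theorem mk_seqA_eq_shift (α : ℝ) (s : ℕ → Mat q) : PowerSeries.mk (seqA α s) =
    PowerSeries.mk (fun j => s (j + 1)) - (α : ℂ) • (X * PowerSeries.mk fun j => s (j + 1)) -
      (α : ℂ) • C (s 0) := by
  rw [X_mul_mk_shift]
  ext1 j
  simp only [map_sub, coeff_mk, coeff_const_smul, seqA, smul_sub]
  abel

theorem mk_modB (β : ℝ) (a : ℕ → Mat q) : PowerSeries.mk (modB β a) =
    -(PowerSeries.mk a - (β : ℂ) • (X * PowerSeries.mk a)) := by
  ext1 j
  cases j with
  | zero =>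
    simp only [map_sub, map_neg, coeff_mk, coeff_const_smul, coeff_zero_X_mul, smul_zero,
      sub_zero, modB]
  | succ j =>
    simp only [coeff_succ_X_mul, map_sub, map_neg, coeff_mk, coeff_const_smul, modB, seqB]
    abel

theorem dominated_modB {a : ℕ → Mat q} (ha : Dominated a) (β : ℝ) :
    Dominated (modB β a) := by
  have h0 : modB β a 0 * mpInv (modB β a 0) =
      a 0 * mpInv (a 0) := by
    simp only [modB, mpInv_neg, neg_mul_neg]
  constructor
  · intro j
    cases j <;> simp [modB, seqB, ha.herm]
  · intro j
    rw [h0]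
    cases j <;> simp only [modB, seqB, mul_neg, mul_sub, mul_smul_comm, ha.proj_mul]

/-- The reciprocal of `-(1 - β z) a(z)` is `-(1 - β z)⁻¹` times that of `a(z)`. -/
theorem Dominated.mk_recip_modB {a : ℕ → Mat q} (ha : Dominated a) (β : ℝ) :
    PowerSeries.mk (recip (modB β a)) -
      (β : ℂ) • (X * PowerSeries.mk (recip (modB β a))) =
      -PowerSeries.mk (recip a) := by
  have hm := dominated_modB ha β
  have h0 : modB β a 0 * mpInv (modB β a 0) =
      a 0 * mpInv (a 0) := by
    simp only [modB, mpInv_neg, neg_mul_neg]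
  have h₁ := hm.mk_mul_mk_recip
  have h₂ := hm.C_proj_mul_mk_recip
  rw [h0] at h₁ h₂
  set Y := PowerSeries.mk (recip (modB β a))
  rw [mk_modB] at h₁
  have h₃ := congrArg (fun y => PowerSeries.mk (recip a) * y) h₁
  simp only [mk_recip_mul_C_proj] at h₃
  rw [← h₃, neg_mul, mul_neg, neg_neg, sub_mul, mul_sub, ← mul_assoc, ha.mk_recip_mul_mk, h₂,
    smul_mul_assoc, mul_smul_comm, (commute_X (PowerSeries.mk a)).symm.eq, mul_assoc _ X,
    ← mul_assoc _ (PowerSeries.mk a), ha.mk_recip_mul_mk, (commute_X Y).symm.eq, ← mul_assoc, h₂]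

/-- The definition of the Schur transform with the reciprocal of `modB` eliminated. -/
theorem mk_schurTransform {α : ℝ} (β : ℝ) {s : ℕ → Mat q} (ha : Dominated (seqA α s)) :
    PowerSeries.mk (schurTransform α β s) -
      (β : ℂ) • (X * PowerSeries.mk (schurTransform α β s)) =
      C (seqA α s 0) * C (mpInv (s 0)) * PowerSeries.mk (seqB β s) *
        PowerSeries.mk (recip (seqA α s)) * C (seqA α s 0) := by
  have h : PowerSeries.mk (schurTransform α β s) = -(C (seqA α s 0) * C (mpInv (s 0)) *
      (PowerSeries.mk (seqB β s) * PowerSeries.mk (recip (modB β (seqA α s)))) *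
        C (seqA α s 0)) := by
    ext1 j
    rw [← mk_cauchyProd, ← map_mul, map_neg, coeff_mul_C, coeff_C_mul, coeff_mk, coeff_mk]
    rfl
  have h' := congrArg (fun y => C (seqA α s 0) * C (mpInv (s 0)) * PowerSeries.mk (seqB β s) * y *
    C (seqA α s 0)) (ha.mk_recip_modB β)
  simp only [mul_neg, neg_mul, mul_sub, sub_mul, mul_smul_comm, smul_mul_assoc] at h'
  rw [eq_neg_iff_add_eq_zero] at h'
  rw [h, eq_comm, ← sub_eq_zero, mul_neg, smul_neg, ← h']
  have hX : ∀ F G H : (Mat q)⟦X⟧, X * (F * G * H) = F * (X * G) * H := by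
    intro F G H
    rw [← mul_assoc, ← mul_assoc, (commute_X F).symm.eq, mul_assoc F]
  simp only [mul_assoc _ (PowerSeries.mk (seqB β s)), hX]
  rw [← mul_assoc (X : (Mat q)⟦X⟧), (commute_X (PowerSeries.mk (seqB β s))).symm.eq, mul_assoc _ X]
  abel

theorem schurTransform_zero {α β : ℝ} {s : ℕ → Mat q} (ha : Dominated (seqA α s))
    (hsa : seqA α s 0 * mpInv (s 0) * s 0 = seqA α s 0) :
    schurTransform α β s 0 = ((β : ℂ) - α) • seqA α s 0 -
      seqA α s 0 * mpInv (s 0) * seqA α s 0 := by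
  have hb : seqB β s 0 = ((β : ℂ) - α) • s 0 - seqA α s 0 := by
    simp only [seqA, seqB]
    module
  have h1 : seqA α s 0 * mpInv (s 0) * s 0 * mpInv (seqA α s 0) * seqA α s 0 = seqA α s 0 := by
    rw [hsa, (mpInv_spec _).mul_mul_left]
  have h2 : seqA α s 0 * mpInv (s 0) * seqA α s 0 * mpInv (seqA α s 0) * seqA α s 0 =
      seqA α s 0 * mpInv (s 0) * seqA α s 0 := by
    rw [mul_assoc _ (mpInv (seqA α s 0)), ← ha.proj_eq, mul_assoc, ha.mul_proj]
  simp only [schurTransform, cauchyProd, zero_add, Finset.sum_range_one, Nat.sub_self, recip_zero,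
    modB, mpInv_neg, hb, mul_neg, neg_mul, neg_neg, mul_sub, sub_mul, smul_mul_assoc,
    mul_smul_comm, ← mul_assoc, h1, h2]

end OneVariable

/-! ### Power series in two commuting variables -/

/-- Power series in two commuting variables with matrix coefficients. -/
abbrev BiSer (q : ℕ) : Type := (Mat q)⟦X⟧⟦X⟧

section TwoVariables
variable {q : ℕ}

/-- The outer variable, as a central element. -/
noncomputable def outerVar (q : ℕ) : Subring.center (BiSer q) :=
  ⟨X, Subring.mem_center_iff.2 fun F => (commute_X F).eq⟩

/-- The inner variable, as a central element. -/
noncomputable def innerVar (q : ℕ) : Subring.center (BiSer q) :=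
  ⟨C X, Subring.mem_center_iff.2 fun F => by
    ext1 j
    rw [coeff_mul_C, coeff_C_mul, (commute_X _).eq]⟩

/-- A complex scalar, as a central element. -/
noncomputable def centralScalar (q : ℕ) (γ : ℂ) : Subring.center (BiSer q) :=
  ⟨algebraMap ℂ _ γ, Subring.mem_center_iff.2 fun F => (Algebra.commutes γ F).symm⟩

theorem outerVar_smul (F : BiSer q) : outerVar q • F = X * F := rfl

theorem innerVar_smul (F : BiSer q) : innerVar q • F = C X * F := rfl

theorem centralScalar_smul (γ : ℂ) (F : BiSer q) : centralScalar q γ • F = γ • F :=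
  (Algebra.smul_def γ F).symm

theorem centralScalar_sub (γ δ : ℂ) :
    centralScalar q (γ - δ) = centralScalar q γ - centralScalar q δ :=
  Subtype.ext (map_sub (algebraMap ℂ (BiSer q)) γ δ)

/-- `φ` substitutes the central element `v` for the variable of a one-variable power series. -/
structure IsSubst (φ : (Mat q)⟦X⟧ →+* BiSer q) (v : Subring.center (BiSer q)) : Prop where
  X_mul : ∀ F, φ (X * F) = v • φ F
  smul : ∀ (γ : ℂ) F, φ (γ • F) = centralScalar q γ • φ F

theorem isSubst_outer : IsSubst (PowerSeries.map (C (R := Mat q))) (outerVar q) := by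
  constructor
  · intro F
    rw [map_mul, map_X, outerVar_smul]
  · intro γ F
    rw [centralScalar_smul]
    ext j k : 2
    simp only [coeff_map, coeff_const_smul, coeff_C]
    split_ifs <;> simp

theorem isSubst_inner : IsSubst (C (R := (Mat q)⟦X⟧)) (innerVar q) := by
  constructor
  · intro F
    rw [map_mul, innerVar_smul]
  · intro γ F
    rw [centralScalar_smul]
    ext j k : 2
    simp only [coeff_const_smul, coeff_C]
    split_ifs <;> simp

theorem isUnit_one_sub_smul_X (γ : ℂ) : IsUnit (1 - γ • X : (Mat q)⟦X⟧) := by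
  have h : constantCoeff (1 - γ • X : (Mat q)⟦X⟧) = ((1 : (Mat q)ˣ) : Mat q) := by
    rw [← coeff_zero_eq_constantCoeff_apply, map_sub, coeff_const_smul]
    simp
  exact ⟨⟨_, _, PowerSeries.mul_invOfUnit _ 1 h, PowerSeries.invOfUnit_mul _ 1 h⟩, rfl⟩

namespace IsSubst
variable {φ : (Mat q)⟦X⟧ →+* BiSer q} {v : Subring.center (BiSer q)} (hφ : IsSubst φ v)
include hφ

/-- The central element `1 - γ v` is the image of the one-variable series `1 - γ z`. -/
theorem one_sub_smul (γ : ℂ) (F : BiSer q) :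
    (1 - centralScalar q γ * v) • F = φ (1 - γ • X) * F := by
  have h := hφ.X_mul 1
  rw [mul_one, map_one] at h
  rw [map_sub, map_one, hφ.smul, h, sub_smul, one_smul, sub_mul, one_mul, smul_mul_assoc,
    smul_mul_assoc, one_mul, mul_smul]

theorem one_sub_smul_cancel (γ : ℂ) {F G : BiSer q}
    (h : (1 - centralScalar q γ * v) • F = (1 - centralScalar q γ * v) • G) : F = G := by
  rw [hφ.one_sub_smul, hφ.one_sub_smul] at h
  exact ((isUnit_one_sub_smul_X γ).map φ).mul_left_cancel h

end IsSubst

/-- The difference of the two variables is regular: a doubly infinite array which is constant along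
antidiagonals and vanishes in its first row is zero. -/
theorem outer_sub_inner_smul_cancel {F G : BiSer q}
    (h : (outerVar q - innerVar q) • F = (outerVar q - innerVar q) • G) : F = G := by
  rw [← sub_eq_zero, ← smul_sub, sub_smul, outerVar_smul, innerVar_smul] at h
  rw [← sub_eq_zero]
  set D := F - G
  have h₀ : ∀ k, coeff k (coeff 0 D) = 0 := by
    intro k
    have := congrArg (fun y => coeff (k + 1) (coeff 0 y)) h
    simpa only [map_sub, coeff_zero_X_mul, coeff_C_mul, coeff_succ_X_mul, map_zero, zero_sub,
      map_neg, neg_eq_zero] using this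
  have h₁ : ∀ j k, coeff k (coeff (j + 1) D) = coeff (k + 1) (coeff j D) := by
    intro j k
    have := congrArg (fun y => coeff (k + 1) (coeff (j + 1) y)) h
    simp only [map_sub, coeff_C_mul, coeff_succ_X_mul, map_zero] at this
    exact (sub_eq_zero.1 this).symm
  have h₂ : ∀ j k, coeff k (coeff j D) = 0 := by
    intro j
    induction j with
    | zero => exact h₀
    | succ j ih => exact fun k => by rw [h₁, ih]
  ext j k : 2
  rw [h₂, map_zero, map_zero]

theorem outerVar_smul_cancel {F G : BiSer q} (h : outerVar q • F = outerVar q • G) : F = G := by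
  ext1 j
  simpa only [outerVar_smul, coeff_succ_X_mul] using congrArg (coeff (j + 1)) h

theorem innerVar_smul_cancel {F G : BiSer q} (h : innerVar q • F = innerVar q • G) : F = G := by
  ext j k : 2
  simpa only [innerVar_smul, coeff_C_mul, coeff_succ_X_mul] using
    congrArg (fun y => coeff (k + 1) (coeff j y)) h

/-- The generating function of the infinite block Hankel matrix of a sequence. -/
noncomputable def hankelSer (f : ℕ → Mat q) : BiSer q :=
  PowerSeries.mk fun j => PowerSeries.mk fun k => f (j + k)

/-- The generating function of the Schur complement of the first block in the infinite block
Hankel matrix of a sequence. -/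
noncomputable def schurHankelSer (f : ℕ → Mat q) : BiSer q :=
  PowerSeries.mk fun j => PowerSeries.mk fun k =>
    f (j + 1 + (k + 1)) - f (j + 1) * mpInv (f 0) * f (k + 1)

theorem coeffMat_hankelSer (n : ℕ) (f : ℕ → Mat q) :
    coeffMat n (hankelSer f) = hankel n f := by
  simp [coeffMat, hankelSer, hankel]

theorem schurHankelSucc_eq (n : ℕ) (f : ℕ → Mat q) : schurHankelSucc n f =
    blockMat n fun j k => f (j + 1 + (k + 1)) - f (j + 1) * mpInv (f 0) * f (k + 1) := by
  have h : (hankel (n + 1) f).submatrix (fun a : Fin q => (0, a)) (fun b : Fin q => (0, b)) =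
      f 0 := rfl
  ext ⟨j, a⟩ ⟨k, b⟩
  rw [schurHankelSucc, h]
  simp only [schurCompl, Matrix.mul_apply, Matrix.sub_apply, submatrix_apply, hankel, blockMat,
    of_apply, Fin.val_succ, Fin.val_zero, add_zero, zero_add]

theorem coeffMat_schurHankelSer (n : ℕ) (f : ℕ → Mat q) :
    coeffMat n (schurHankelSer f) = schurHankelSucc n f := by
  simp [coeffMat, schurHankelSer, schurHankelSucc_eq]

/-- The displacement equation `(z - w) H(z, w) = z f(z) - w f(w)` of a Hankel matrix. -/
theorem sub_smul_hankelSer (f : ℕ → Mat q) : (outerVar q - innerVar q) • hankelSer f =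
    outerVar q • PowerSeries.map C (PowerSeries.mk f) -
      innerVar q • C (PowerSeries.mk f) := by
  simp only [sub_smul, outerVar_smul, innerVar_smul]
  ext j k : 2
  cases j <;> cases k <;>
    simp only [map_sub, coeff_zero_X_mul, coeff_C_mul, coeff_succ_X_mul, coeff_C, map_zero,
      hankelSer, coeff_mk, coeff_map, if_true, if_false, Nat.succ_ne_zero, mul_zero, add_zero,
      zero_add, sub_self, sub_zero]
  rw [add_right_comm, add_assoc, sub_self]

/-- The displacement equation of the Schur complement, in terms of the shifted series. -/
theorem sub_smul_schurHankelSer (f : ℕ → Mat q) :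
    (outerVar q - innerVar q) • schurHankelSer f =
    PowerSeries.map C (PowerSeries.mk fun j => f (j + 1)) -
      C (PowerSeries.mk fun j => f (j + 1)) - (outerVar q - innerVar q) •
      (PowerSeries.map C (PowerSeries.mk fun j => f (j + 1)) * C (C (mpInv (f 0))) *
        C (PowerSeries.mk fun j => f (j + 1))) := by
  have h : schurHankelSer f = hankelSer (fun j => f (j + 2)) -
      PowerSeries.map C (PowerSeries.mk fun j => f (j + 1)) * C (C (mpInv (f 0))) *
        C (PowerSeries.mk fun j => f (j + 1)) := by
    ext j k : 2
    simp only [schurHankelSer, hankelSer, coeff_mk, map_sub, coeff_mul_C, coeff_map, coeff_C_mul,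
      ← map_mul]
    rw [show j + 1 + (k + 1) = j + k + 2 by ring]
  rw [h, smul_sub]
  congr 1
  simp only [sub_smul, outerVar_smul, innerVar_smul]
  ext j k : 2
  cases j <;> cases k <;>
    simp only [map_sub, coeff_zero_X_mul, coeff_C_mul, coeff_succ_X_mul, coeff_C, map_zero,
      hankelSer, coeff_mk, coeff_map, if_true, if_false, Nat.succ_ne_zero, add_zero,
      zero_add, sub_self, sub_zero]
  rw [sub_eq_zero]
  congr 1
  omega

end TwoVariables

/-! ### Generating functions of the Hankel matrices of the Schur transform -/

section
variable {q : ℕ} {α : ℝ} {s : ℕ → Mat q}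

theorem Dominated.seqA_mul_proj (hs : Dominated s) (j : ℕ) :
    seqA α s j * (s 0 * mpInv (s 0)) = seqA α s j := by
  simp only [seqA, add_mul, neg_mul, smul_mul_assoc, hs.mul_proj]

theorem Dominated.proj_mul_seqA (hs : Dominated s) (j : ℕ) :
    s 0 * mpInv (s 0) * seqA α s j = seqA α s j := by
  simp only [seqA, mul_add, mul_neg, mul_smul_comm, hs.proj_mul]

theorem Dominated.seqA_mul_mpInv_mul (hs : Dominated s) :
    seqA α s 0 * mpInv (s 0) * s 0 = seqA α s 0 := by
  rw [mul_assoc, ← hs.proj_eq, hs.seqA_mul_proj]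

namespace IsSubst
variable {φ : (Mat q)⟦X⟧ →+* BiSer q} {v : Subring.center (BiSer q)} (hφ : IsSubst φ v)
include hφ

theorem smul_seqB (β : ℝ) (t : ℕ → Mat q) : v • φ (PowerSeries.mk (seqB β t)) =
    φ (C (t 0)) - (1 - centralScalar q β * v) • φ (PowerSeries.mk t) := by
  have h := congrArg φ (X_mul_mk_seqB β t)
  simp only [hφ.X_mul, hφ.smul, map_sub] at h
  rw [h]
  module

theorem smul_seqA (α : ℝ) (t : ℕ → Mat q) : v • φ (PowerSeries.mk (seqA α t)) =
    (1 - centralScalar q α * v) • φ (PowerSeries.mk t) - φ (C (t 0)) := by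
  have h := congrArg φ (X_mul_mk_seqA α t)
  simp only [hφ.X_mul, hφ.smul, map_sub] at h
  rw [h]
  module

theorem smul_shift (f : ℕ → Mat q) : v • φ (PowerSeries.mk fun j => f (j + 1)) =
    φ (PowerSeries.mk f) - φ (C (f 0)) := by
  have h := congrArg φ (X_mul_mk_shift f)
  simpa only [hφ.X_mul, map_sub] using h

theorem seqA_eq_shift (α : ℝ) (t : ℕ → Mat q) : φ (PowerSeries.mk (seqA α t)) =
    (1 - centralScalar q α * v) • φ (PowerSeries.mk fun j => t (j + 1)) -
      centralScalar q α • φ (C (t 0)) := by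
  have h := congrArg φ (mk_seqA_eq_shift α t)
  simp only [hφ.X_mul, hφ.smul, map_sub] at h
  rw [h]
  module

theorem smul_smul_schurTransform (β : ℝ) (hs : Dominated s) (ha : Dominated (seqA α s)) :
    (1 - centralScalar q α * v) • (1 - centralScalar q β * v) •
        φ (PowerSeries.mk (schurTransform α β s)) =
      centralScalar q (β - α) • (φ (C (seqA α s 0)) * φ (PowerSeries.mk (recip (seqA α s))) *
        φ (C (seqA α s 0))) - (1 - centralScalar q β * v) •
        (φ (C (seqA α s 0)) * φ (C (mpInv (s 0))) * φ (C (seqA α s 0))) := by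
  apply schur_transform_eq (A := φ (PowerSeries.mk (seqA α s)))
    (B := φ (PowerSeries.mk (seqB β s))) (s₀ := φ (C (s 0)))
    (Q := φ (C (seqA α s 0 * mpInv (seqA α s 0))))
  · have h := congrArg φ (mk_seqA_add_mk_seqB α β s)
    simp only [hφ.X_mul, hφ.smul, map_sub, map_add] at h
    rw [← h]
    module
  · have h := congrArg φ (mk_schurTransform β ha)
    simp only [hφ.X_mul, hφ.smul, map_sub] at h
    simp only [map_mul] at h
    rw [← h]
    module
  · rw [← map_mul, ha.mk_mul_mk_recip]
  · rw [← map_mul, ← map_mul, ha.proj_mul]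
  · rw [← map_mul, ← map_mul, ← map_mul, ← map_mul, hs.seqA_mul_mpInv_mul]

theorem schurTransform_zero_eq (β : ℝ) (hs : Dominated s) (ha : Dominated (seqA α s)) :
    φ (C (schurTransform α β s 0)) = centralScalar q (β - α) • φ (C (seqA α s 0)) -
      φ (C (seqA α s 0)) * φ (C (mpInv (s 0))) * φ (C (seqA α s 0)) := by
  rw [schurTransform_zero ha hs.seqA_mul_mpInv_mul, ← hφ.smul, ← map_mul, ← map_mul, ← map_mul,
    ← map_mul, ← map_sub]
  congr 1
  ext1 j
  simp only [map_sub, coeff_const_smul, coeff_C]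
  split_ifs <;> simp

theorem smul_smul_seqA_schurTransform (β : ℝ) (hs : Dominated s) (ha : Dominated (seqA α s)) :
    (1 - centralScalar q β * v) • v •
        φ (PowerSeries.mk (seqA α (schurTransform α β s))) =
      centralScalar q (β - α) • (φ (C (seqA α s 0)) * φ (PowerSeries.mk (recip (seqA α s))) *
        φ (C (seqA α s 0)) - (1 - centralScalar q β * v) • φ (C (seqA α s 0))) :=
  schur_transform_seqA_eq (hφ.smul_smul_schurTransform β hs ha)
    (hφ.schurTransform_zero_eq β hs ha) (hφ.smul_seqA α _)

theorem smul_smul_seqB_schurTransform (β : ℝ) (hs : Dominated s) (ha : Dominated (seqA α s)) :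
    (1 - centralScalar q α * v) • v •
        φ (PowerSeries.mk (seqB β (schurTransform α β s))) =
      centralScalar q (β - α) • ((1 - centralScalar q α * v) • φ (C (seqA α s 0)) -
        v • (φ (C (seqA α s 0)) * φ (C (mpInv (s 0))) * φ (C (seqA α s 0))) -
        φ (C (seqA α s 0)) * φ (PowerSeries.mk (recip (seqA α s))) * φ (C (seqA α s 0))) :=
  schur_transform_seqB_eq (centralScalar_sub _ _) (hφ.smul_smul_schurTransform β hs ha)
    (hφ.schurTransform_zero_eq β hs ha) (hφ.smul_seqB β _)

theorem smul_smul_seqAB_schurTransform (β : ℝ) (hs : Dominated s) (ha : Dominated (seqA α s)) :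
    v • v • φ (PowerSeries.mk (seqAB α β (schurTransform α β s))) =
      v • φ (C (seqA α (schurTransform α β s) 0)) -
      centralScalar q (β - α) • (φ (C (seqA α s 0)) * φ (PowerSeries.mk (recip (seqA α s))) *
        φ (C (seqA α s 0)) - (1 - centralScalar q β * v) • φ (C (seqA α s 0))) := by
  rw [seqAB_eq]
  exact schur_transform_seqAB_eq (hφ.smul_smul_seqA_schurTransform β hs ha) (hφ.smul_seqB β _)

end IsSubst

theorem hankelSer_seqA_schurTransform (β : ℝ) (hs : Dominated s) (ha : Dominated (seqA α s)) :
    (1 - centralScalar q β * outerVar q) • (1 - centralScalar q β * innerVar q) •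
        hankelSer (seqA α (schurTransform α β s)) =
      centralScalar q (β - α) • (C (C (seqA α s 0)) *
        PowerSeries.map C (PowerSeries.mk (recip (seqA α s))) * hankelSer (seqAB α β s) *
        C (PowerSeries.mk (recip (seqA α s))) * C (C (seqA α s 0))) := by
  have hmap : ∀ M : Mat q, PowerSeries.map C (C M) = C (C M) := fun M => map_C _ M
  have hU := isSubst_outer.smul_smul_seqA_schurTransform β hs ha
  have hC := isSubst_outer.smul_seqB β (seqA α s)
  rw [hmap] at hU hC
  rw [← seqAB_eq] at hC
  have hC' := isSubst_inner.smul_seqB β (seqA α s)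
  rw [← seqAB_eq] at hC'
  refine outer_sub_inner_smul_cancel (hankel_seqA_identity hU
    (isSubst_inner.smul_smul_seqA_schurTransform β hs ha) hC hC' (sub_smul_hankelSer _)
    (sub_smul_hankelSer _) (Q := C (C (seqA α s 0 * mpInv (seqA α s 0)))) ?_ ?_ ?_ ?_)
  · rw [← map_mul, ha.mk_recip_mul_mk, hmap]
  · rw [← map_mul, ha.mk_mul_mk_recip]
  · rw [← map_mul, ← map_mul, ha.mul_proj]
  · rw [← map_mul, ← map_mul, ha.proj_mul]

theorem hankelSer_seqB_schurTransform (β : ℝ) (hs : Dominated s) (ha : Dominated (seqA α s)) :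
    hankelSer (seqB β (schurTransform α β s)) =
      centralScalar q (β - α) • (C (C (seqA α s 0)) *
        PowerSeries.map C (PowerSeries.mk (recip (seqA α s))) * schurHankelSer s *
        C (PowerSeries.mk (recip (seqA α s))) * C (C (seqA α s 0))) := by
  have hmap : ∀ M : Mat q, PowerSeries.map C (C M) = C (C M) := fun M => map_C _ M
  have hV := isSubst_outer.smul_smul_seqB_schurTransform β hs ha
  have hS := isSubst_outer.seqA_eq_shift α s
  rw [hmap] at hV hS
  rw [hmap] at hV
  apply isSubst_inner.one_sub_smul_cancel α
  apply isSubst_outer.one_sub_smul_cancel α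
  apply outer_sub_inner_smul_cancel
  have key := hankel_seqB_identity hV
    (isSubst_inner.smul_smul_seqB_schurTransform β hs ha) hS (isSubst_inner.seqA_eq_shift α s)
    (sub_smul_hankelSer _) (sub_smul_schurHankelSer s)
    (Q := C (C (seqA α s 0 * mpInv (seqA α s 0)))) (P := C (C (s 0 * mpInv (s 0))))
    ?_ ?_ ?_ ?_ ?_ ?_ ?_ ?_ ?_
  · rw [smul_comm (1 - centralScalar q α * outerVar q)] at key ⊢
    rw [key]
    module
  · rw [← map_mul, ← map_mul]
  · rw [← map_mul, ← map_mul, ← hs.proj_eq]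
  · rw [← hmap, ← map_mul]
    congr 1
    ext1 j
    rw [coeff_mul_C, coeff_mk, hs.seqA_mul_proj]
  · rw [← map_mul]
    congr 1
    ext1 j
    rw [coeff_C_mul, coeff_mk, hs.proj_mul_seqA]
  · rw [← map_mul, ← map_mul, hs.proj_mul]
  · rw [← map_mul, ha.mk_recip_mul_mk, hmap]
  · rw [← map_mul, ha.mk_mul_mk_recip]
  · rw [← map_mul, ← map_mul, ha.mul_proj]
  · rw [← map_mul, ← map_mul, ha.proj_mul]

theorem hankelSer_seqAB_schurTransform (β : ℝ) (hs : Dominated s) (ha : Dominated (seqA α s)) :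
    hankelSer (seqAB α β (schurTransform α β s)) =
      centralScalar q (β - α) • (C (C (seqA α s 0)) *
        PowerSeries.map C (PowerSeries.mk (recip (seqA α s))) * schurHankelSer (seqA α s) *
        C (PowerSeries.mk (recip (seqA α s))) * C (C (seqA α s 0))) := by
  have hmap : ∀ M : Mat q, PowerSeries.map C (C M) = C (C M) := fun M => map_C _ M
  have hW := isSubst_outer.smul_smul_seqAB_schurTransform β hs ha
  have hS := isSubst_outer.smul_shift (seqA α s)
  rw [hmap] at hW hS
  rw [hmap] at hW
  apply innerVar_smul_cancel
  apply outerVar_smul_cancel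
  apply outer_sub_inner_smul_cancel
  refine hankel_seqAB_identity hW
    (isSubst_inner.smul_smul_seqAB_schurTransform β hs ha) hS
    (isSubst_inner.smul_shift (seqA α s))
    (sub_smul_hankelSer _) (sub_smul_schurHankelSer (seqA α s))
    (Q := C (C (seqA α s 0 * mpInv (seqA α s 0)))) ?_ ?_ ?_ ?_ ?_ ?_ ?_ ?_
  · rw [← map_mul, ← map_mul]
  · rw [← map_mul, ← map_mul, ← ha.proj_eq]
  · rw [← hmap, ← map_mul, ha.mk_mul_C_proj]
  · rw [← map_mul, ha.C_proj_mul_mk]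
  · rw [← map_mul, ha.mk_recip_mul_mk, hmap]
  · rw [← map_mul, ha.mk_mul_mk_recip]
  · rw [← map_mul, ← map_mul, ha.mul_proj]
  · rw [← map_mul, ← map_mul, ha.proj_mul]

end

/-! ### Extraction of the matrix factorizations -/

section
variable {n q : ℕ}

theorem blockMat_sub (f g : ℕ → ℕ → Mat q) :
    blockMat n f - blockMat n g = blockMat n fun j k => f j k - g j k := rfl

theorem repDiag_mul_blockMat (M : Mat q) (f : ℕ → ℕ → Mat q) :
    repDiag n M * blockMat n f = blockMat n fun j k => M * f j k := by
  rw [repDiag, blockMat_mul]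
  refine blockMat_congr fun j hj k _ => ?_
  simp only [ite_mul, zero_mul]
  rw [Finset.sum_ite_eq, if_pos (Finset.mem_range.2 (by omega))]

theorem coeffMat_smul (γ : ℂ) (K : BiSer q) :
    coeffMat n (centralScalar q γ • K) = γ • coeffMat n K := by
  rw [centralScalar_smul]
  rfl

theorem coeffMat_sandwich {M : Mat q} {Y : (Mat q)⟦X⟧} (hM : Mᴴ = M) (hY : serStar Y = Y)
    (K : BiSer q) :
    coeffMat n (C (C M) * PowerSeries.map C Y * K * C Y * C (C M)) =
      repDiag n M * serToepL n Y * coeffMat n K * (repDiag n M * serToepL n Y)ᴴ := by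
  have h : C (C M) * PowerSeries.map C Y * K * C Y * C (C M) =
      PowerSeries.map C (C M * Y) * (K * C (Y * C M)) := by
    rw [map_mul, map_mul, map_C]
    simp only [mul_assoc]
  rw [h, coeffMat_map_C_mul, coeffMat_mul_C, serStar_mul, serStar_C, hM, hY, serToepL_mul,
    serToepL_C, Matrix.mul_assoc _ (coeffMat n K)]

theorem serToepL_one_sub (γ : ℂ) :
    serToepL n (1 - γ • X : (Mat q)⟦X⟧) = 1 - γ • shiftT n q := by
  rw [← repDiag_one, repDiag, shiftT, smul_blockMat, blockMat_sub, serToepL, toepL]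
  refine blockMat_congr fun j _ k _ => ?_
  simp only [map_sub, coeff_const_smul, coeff_one, coeff_X]
  split_ifs <;> first | omega | simp

theorem serStar_one_sub (β : ℝ) :
    serStar (1 - (β : ℂ) • X : (Mat q)⟦X⟧) = 1 - (β : ℂ) • X := by
  ext1 j
  simp only [serStar, coeff_mk, map_sub, coeff_const_smul, coeff_one, coeff_X]
  split_ifs <;> simp

/-- The resolvent `R_n(γ)` is the Toeplitz matrix of the geometric series `(1 - γ z)⁻¹`. -/
theorem exists_serToepL_eq_resolv (n : ℕ) {q : ℕ} (γ : ℂ) :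
    ∃ G : (Mat q)⟦X⟧, coeff 0 G = 1 ∧ G * (1 - γ • X) = 1 ∧ resolv n q γ = serToepL n G := by
  obtain ⟨u, hu⟩ := isUnit_one_sub_smul_X (q := q) γ
  have hG : (↑u⁻¹ : (Mat q)⟦X⟧) * (1 - γ • X) = 1 := by rw [← hu, Units.inv_mul]
  refine ⟨↑u⁻¹, ?_, hG, ?_⟩
  · have h := congrArg (coeff 0) hG
    simpa [coeff_mul, mul_sub, coeff_const_smul] using h
  · rw [resolv, ← serToepL_one_sub]
    exact Matrix.inv_eq_left_inv (by rw [← serToepL_mul, hG, serToepL_one])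

theorem hankel_conjTranspose {f : ℕ → Mat q} (hf : ∀ j, (f j)ᴴ = f j) :
    (hankel n f)ᴴ = hankel n f := by
  rw [hankel, blockMat_conjTranspose]
  exact blockMat_congr fun j _ k _ => by rw [hf, add_comm]

theorem schurHankelSucc_conjTranspose {f : ℕ → Mat q} (hf : ∀ j, (f j)ᴴ = f j) :
    (schurHankelSucc n f)ᴴ = schurHankelSucc n f := by
  rw [schurHankelSucc_eq, blockMat_conjTranspose]
  refine blockMat_congr fun j _ k _ => ?_
  simp only [conjTranspose_sub, conjTranspose_mul, hf, conjTranspose_mpInv (hf 0),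
    Matrix.mul_assoc]
  rw [add_comm (k + 1)]

/-- Two left factors with the same effect on a Hermitian matrix define the same congruence of it. -/
theorem congruence_eq_of_mul_eq {F D L : BMat n q} (h : D * L = F * L) (hL : Lᴴ = L) :
    F * L * Fᴴ = D * L * Dᴴ := by
  have h' : L * Fᴴ = L * Dᴴ := by
    have := congrArg conjTranspose h
    rw [conjTranspose_mul, conjTranspose_mul, hL] at this
    exact this.symm
  rw [← h, Matrix.mul_assoc, h', Matrix.mul_assoc]

theorem Dominated.mpInv_toepL {f : ℕ → Mat q} (hf : Dominated f) :
    mpInv (toepL n f) = toepL n (recip f) := by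
  apply IsMoorePenrose.mpInv_eq
  simp only [← serToepL_mk]
  have hP : (repDiag n (f 0 * mpInv (f 0)))ᴴ = repDiag n (f 0 * mpInv (f 0)) := by
    rw [repDiag_conjTranspose, (mpInv_spec (f 0)).herm_left]
  constructor
  · rw [← serToepL_mul, ← serToepL_mul, hf.mk_mul_mk_recip, hf.C_proj_mul_mk]
  · rw [← serToepL_mul, ← serToepL_mul, hf.mk_recip_mul_mk, hf.C_proj_mul_mk_recip]
  · rw [← serToepL_mul, hf.mk_mul_mk_recip, serToepL_C, hP]
  · rw [← serToepL_mul, hf.mk_recip_mul_mk, serToepL_C, hP]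

theorem toepU_eq {f : ℕ → Mat q} (hf : ∀ j, (f j)ᴴ = f j) : toepU n f = (toepL n f)ᴴ := by
  rw [toepL_conjTranspose]
  simp only [hf]

theorem Dominated.mpInv_toepU {f : ℕ → Mat q} (hf : Dominated f) :
    mpInv (toepU n f) = (toepL n (recip f))ᴴ := by
  rw [toepU_eq hf.herm, mpInv_conjTranspose, hf.mpInv_toepL]

theorem facL_eq (n : ℕ) {q : ℕ} (f : ℕ → Mat q) : facL n f = serToepL n
    (C (f 0) * PowerSeries.mk (recip f) + C (1 - f 0 * mpInv (f 0))) := by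
  rw [facL, serToepL_add, serToepL_mul, serToepL_C, serToepL_C, serToepL_mk]

theorem coeff_zero_facL (f : ℕ → Mat q) :
    coeff 0 (C (f 0) * PowerSeries.mk (recip f) + C (1 - f 0 * mpInv (f 0))) = 1 := by
  rw [map_add, coeff_C_mul, coeff_mk, coeff_zero_C, recip_zero]
  abel

theorem Dominated.facU_eq {f : ℕ → Mat q} (hf : Dominated f) : facU n f = (facL n f)ᴴ := by
  rw [facU, facL, conjTranspose_add, conjTranspose_mul, repDiag_conjTranspose,
    repDiag_conjTranspose, hf.herm, conjTranspose_sub, conjTranspose_one,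
    (mpInv_spec (f 0)).herm_left, hf.proj_eq, toepU_eq hf.recip_herm]

theorem facL_mul_of_proj_mul {f : ℕ → Mat q} {g : ℕ → ℕ → Mat q}
    (h : ∀ j k, f 0 * mpInv (f 0) * g j k = g j k) :
    facL n f * blockMat n g = repDiag n (f 0) * toepL n (recip f) * blockMat n g := by
  have h0 : repDiag n (1 - f 0 * mpInv (f 0)) * blockMat n g = 0 := by
    rw [repDiag_mul_blockMat]
    simp only [sub_mul, one_mul, h, sub_self]
    rfl
  rw [facL, Matrix.add_mul, h0, add_zero]

variable {α : ℝ} {s : ℕ → Mat q}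

theorem hankel_seqAB_eq (β : ℝ) (hs : Dominated s) (ha : Dominated (seqA α s)) :
    hankel n (seqAB α β (schurTransform α β s)) =
      ((β - α : ℝ) : ℂ) • (repDiag n (seqA α s 0) * toepL n (recip (seqA α s)) *
        schurHankelSucc n (seqA α s) *
          (repDiag n (seqA α s 0) * toepL n (recip (seqA α s)))ᴴ) := by
  rw [← coeffMat_hankelSer, hankelSer_seqAB_schurTransform β hs ha, coeffMat_smul,
    coeffMat_sandwich (ha.herm 0) ha.serStar_mk_recip, coeffMat_schurHankelSer, serToepL_mk,
    Complex.ofReal_sub]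

theorem hankel_seqB_eq (β : ℝ) (hs : Dominated s) (ha : Dominated (seqA α s)) :
    hankel n (seqB β (schurTransform α β s)) =
      ((β - α : ℝ) : ℂ) • (repDiag n (seqA α s 0) * toepL n (recip (seqA α s)) *
        schurHankelSucc n s *
          (repDiag n (seqA α s 0) * toepL n (recip (seqA α s)))ᴴ) := by
  rw [← coeffMat_hankelSer, hankelSer_seqB_schurTransform β hs ha, coeffMat_smul,
    coeffMat_sandwich (ha.herm 0) ha.serStar_mk_recip, coeffMat_schurHankelSer, serToepL_mk,
    Complex.ofReal_sub]

theorem smul_smul_eq_map_C_mul (γ : ℂ) (K : BiSer q) :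
    (1 - centralScalar q γ * outerVar q) • (1 - centralScalar q γ * innerVar q) • K =
      PowerSeries.map C (1 - γ • X) * (K * C (1 - γ • X)) := by
  have h : C (1 - γ • X : (Mat q)⟦X⟧) = (1 - centralScalar q γ * innerVar q) • (1 : BiSer q) := by
    rw [isSubst_inner.one_sub_smul, mul_one]
  rw [isSubst_outer.one_sub_smul, h, mul_smul_comm _ K (1 : BiSer q), mul_one]

theorem hankel_seqA_eq (β : ℝ) (hs : Dominated s) (ha : Dominated (seqA α s)) :
    hankel n (seqA α (schurTransform α β s)) =
      ((β - α : ℝ) : ℂ) • (resolv n q β *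
        (repDiag n (seqA α s 0) * toepL n (recip (seqA α s)) * hankel n (seqAB α β s) *
          (repDiag n (seqA α s 0) * toepL n (recip (seqA α s)))ᴴ) * (resolv n q β)ᴴ) := by
  have h := congrArg (coeffMat n) (hankelSer_seqA_schurTransform β hs ha)
  rw [coeffMat_smul, coeffMat_sandwich (ha.herm 0) ha.serStar_mk_recip, coeffMat_hankelSer,
    serToepL_mk] at h
  set K := hankelSer (seqA α (schurTransform α β s))
  rw [smul_smul_eq_map_C_mul, coeffMat_map_C_mul, coeffMat_mul_C, serStar_one_sub, coeffMat_hankelSer] at h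
  obtain ⟨G, -, hG, hR⟩ := exists_serToepL_eq_resolv n (q := q) β
  have hR₁ : resolv n q β * serToepL n (1 - (β : ℂ) • X) = 1 := by
    rw [hR, ← serToepL_mul, hG, serToepL_one]
  have hR₂ : (serToepL n (1 - (β : ℂ) • X))ᴴ * (resolv n q β)ᴴ = 1 := by
    rw [← conjTranspose_mul, hR₁, conjTranspose_one]
  rw [Complex.ofReal_sub, ← Matrix.smul_mul, ← Matrix.mul_smul, ← h]
  calc _ = (resolv n q β * serToepL n (1 - (β : ℂ) • X)) *
        hankel n (seqA α (schurTransform α β s)) *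
          ((serToepL n (1 - (β : ℂ) • X))ᴴ * (resolv n q β)ᴴ) := by
        rw [hR₁, hR₂, Matrix.one_mul, Matrix.mul_one]
    _ = _ := by simp only [Matrix.mul_assoc]

theorem Dominated.seqA_proj_mul_seqAB (β : ℝ) (ha : Dominated (seqA α s)) (j : ℕ) :
    seqA α s 0 * mpInv (seqA α s 0) * seqAB α β s j = seqAB α β s j := by
  simp only [seqAB_eq, seqB, mul_sub, mul_smul_comm, ha.proj_mul]

theorem Dominated.seqAB_herm (β : ℝ) (ha : Dominated (seqA α s)) (j : ℕ) :
    (seqAB α β s j)ᴴ = seqAB α β s j := by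
  simp [seqAB_eq, seqB, ha.herm]

/-- On the orthogonal complement of the range of `a_0`, the sequence is geometric of ratio `α`. -/
theorem Dominated.seqA_proj_mul (ha : Dominated (seqA α s)) (j m : ℕ) :
    (1 - seqA α s 0 * mpInv (seqA α s 0)) * s (j + m) =
      (α : ℂ) ^ j • ((1 - seqA α s 0 * mpInv (seqA α s 0)) * s m) := by
  induction j with
  | zero => simp
  | succ j ih =>
    have hsucc : s (j + 1 + m) = seqA α s (j + m) + (α : ℂ) • s (j + m) := by
      rw [add_right_comm]
      simp only [seqA]
      abel
    have h0 : (1 - seqA α s 0 * mpInv (seqA α s 0)) * seqA α s (j + m) = 0 := by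
      rw [sub_mul, one_mul, ha.proj_mul, sub_self]
    rw [hsucc, mul_add, h0, zero_add, mul_smul_comm, ih, smul_smul, pow_succ']

/-- The ranges of the blocks of the Schur complement lie in the range of `a₀`: on the orthogonal
complement of that range the moments are geometric, `s_j = α ^ j s₀`. -/
theorem Dominated.seqA_proj_mul_schur (hs : Dominated s) (ha : Dominated (seqA α s)) (j k : ℕ) :
    seqA α s 0 * mpInv (seqA α s 0) *
        (s (j + 1 + (k + 1)) - s (j + 1) * mpInv (s 0) * s (k + 1)) =
      s (j + 1 + (k + 1)) - s (j + 1) * mpInv (s 0) * s (k + 1) := by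
  have h : (1 - seqA α s 0 * mpInv (seqA α s 0)) *
      (s (j + 1 + (k + 1)) - s (j + 1) * mpInv (s 0) * s (k + 1)) = 0 := by
    have h0 := ha.seqA_proj_mul (j + 1) 0
    rw [add_zero] at h0
    rw [mul_sub, ha.seqA_proj_mul, ← mul_assoc, ← mul_assoc, h0, smul_mul_assoc, smul_mul_assoc,
      mul_assoc _ (s 0), mul_assoc _ (s 0 * mpInv (s 0)), hs.proj_mul, sub_self]
  rw [sub_mul, one_mul, sub_eq_zero] at h
  exact h.symm

/-- The ranges of the blocks of the Schur complement lie in the range of `s_0`. -/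
theorem Dominated.proj_mul_schur (hs : Dominated s) (j k : ℕ) :
    s 0 * mpInv (s 0) * (s (j + 1 + (k + 1)) - s (j + 1) * mpInv (s 0) * s (k + 1)) =
      s (j + 1 + (k + 1)) - s (j + 1) * mpInv (s 0) * s (k + 1) := by
  rw [mul_sub, hs.proj_mul, ← mul_assoc, ← mul_assoc, hs.proj_mul]

theorem facL₂_eq (n : ℕ) {q : ℕ} (f g : ℕ → Mat q) : facL₂ n f g = serToepL n
    (C (f 0) * PowerSeries.mk (recip f) * PowerSeries.mk g * C (mpInv (g 0)) +
      C (1 - f 0 * mpInv (f 0) * g 0 * mpInv (g 0))) := by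
  simp only [facL₂, serToepL_add, serToepL_mul, serToepL_C, serToepL_mk]

theorem coeff_zero_facL₂ (f g : ℕ → Mat q) :
    coeff 0 (C (f 0) * PowerSeries.mk (recip f) * PowerSeries.mk g * C (mpInv (g 0)) +
      C (1 - f 0 * mpInv (f 0) * g 0 * mpInv (g 0))) = 1 := by
  rw [map_add, coeff_mul_C, coeff_mul]
  simp [recip_zero]

theorem facU₂_eq {f g : ℕ → Mat q} (hf : Dominated f) (hg : Dominated g) :
    facU₂ n f g = (facL₂ n f g)ᴴ := by
  simp only [facU₂, facL₂, conjTranspose_add, conjTranspose_mul, repDiag_conjTranspose, hf.herm,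
    hg.herm, conjTranspose_sub, conjTranspose_one, conjTranspose_mpInv (hf.herm 0),
    conjTranspose_mpInv (hg.herm 0), toepU_eq hg.herm, toepU_eq hf.recip_herm, Matrix.mul_assoc]

/-- The product `D_n^{a,s} D_n^s` acts on `L_{n+1}^s` like `⟨a_0⟩ S_n^{a^♯}`: the two factors
telescope, and the diagonal correction in `D_n^{a,s}` contributes nothing because the range of
`L_{n+1}^s` lies in that of `a_0`. -/
theorem facL₂_mul_facL_mul_schurHankelSucc (hs : Dominated s) (ha : Dominated (seqA α s)) :
    facL₂ n (seqA α s) s * facL n s * schurHankelSucc n s =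
      repDiag n (seqA α s 0) * toepL n (recip (seqA α s)) * schurHankelSucc n s := by
  set a := seqA α s
  set P := s 0 * mpInv (s 0) with hP
  set Q := a 0 * mpInv (a 0) with hQ
  have hPQ : P * Q = Q := by rw [hQ, ← mul_assoc, hs.proj_mul_seqA]
  have hQP : Q * P = Q := by
    have h := congrArg conjTranspose hPQ
    rwa [conjTranspose_mul, (mpInv_spec (s 0)).herm_left, (mpInv_spec (a 0)).herm_left] at h
  have h₁ : facL n s * schurHankelSucc n s =
      serToepL n (C (s 0) * PowerSeries.mk (recip s)) * schurHankelSucc n s := by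
    rw [schurHankelSucc_eq, facL_mul_of_proj_mul hs.proj_mul_schur, serToepL_mul, serToepL_C,
      serToepL_mk]
  have h₂ : C (a 0) * PowerSeries.mk (recip a) * PowerSeries.mk s * C (mpInv (s 0)) *
      (C (s 0) * PowerSeries.mk (recip s)) = C (a 0) * PowerSeries.mk (recip a) := by
    have e : C (mpInv (s 0)) * (C (s 0) * PowerSeries.mk (recip s)) =
        PowerSeries.mk (recip s) := by
      rw [← mul_assoc, ← map_mul, ← hs.proj_eq, hs.C_proj_mul_mk_recip]
    rw [mul_assoc _ (C (mpInv (s 0))), e, mul_assoc _ (PowerSeries.mk s), hs.mk_mul_mk_recip,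
      mul_assoc, ← mk_recip_mul_C_proj a, mul_assoc (PowerSeries.mk (recip a)), ← map_mul, ← hP,
      ← hQ, hQP]
  have h₃ : C (1 - Q) * (C (s 0) * PowerSeries.mk (recip s)) =
      (1 - (α : ℂ) • X) * C (P - Q) := by
    -- Off the range of `Q` the series `s(z)` equals `(1 - α z)⁻¹ s_0`, since `a(z)` vanishes there.
    have hS : C (1 - Q) * C (s 0) = (1 - (α : ℂ) • X) * (C (1 - Q) * PowerSeries.mk s) := by
      have h := congrArg (fun y => C (1 - Q) * y) (X_mul_mk_seqA α s)
      have hQa : C (1 - Q) * PowerSeries.mk a = 0 := by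
        rw [map_sub, map_one, sub_mul, one_mul, ha.C_proj_mul_mk, sub_self]
      simp only [mul_sub, mul_smul_comm] at h
      rw [← mul_assoc, (commute_X (C (1 - Q))).eq, mul_assoc, hQa, mul_zero, ← mul_assoc _ X,
        (commute_X (C (1 - Q))).eq, mul_assoc X] at h
      rw [sub_mul, one_mul, smul_mul_assoc, eq_comm]
      exact sub_eq_zero.1 h.symm
    rw [← mul_assoc, hS, mul_assoc, mul_assoc, hs.mk_mul_mk_recip, ← map_mul, ← hP,
      sub_mul 1 Q P, one_mul, hQP]
  -- Both `P` and `Q` fix the Schur complement.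
  have h₄ : serToepL n (C (P - Q)) * schurHankelSucc n s = 0 := by
    rw [serToepL_C, schurHankelSucc_eq, repDiag_mul_blockMat]
    simp only [sub_mul P Q, hs.proj_mul_schur, hs.seqA_proj_mul_schur ha, sub_self, P, Q, a]
    rfl
  have hQ' : a 0 * mpInv (a 0) * s 0 * mpInv (s 0) = Q := by rw [mul_assoc, ← hP, ← hQ, hQP]
  rw [Matrix.mul_assoc, h₁, facL₂_eq, hQ', ← Matrix.mul_assoc, ← serToepL_mul, add_mul, h₂, h₃,
    serToepL_add, Matrix.add_mul, serToepL_mul (1 - (α : ℂ) • X),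
    Matrix.mul_assoc _ _ (schurHankelSucc n s), h₄, Matrix.mul_zero, add_zero, serToepL_mul,
    serToepL_C, serToepL_mk]

end

/-! ### Non-negative definite sequences are dominated by their first term -/

section
variable {q : ℕ}

theorem posSemidef_of_hankel {k n : ℕ} (hk : k ≤ n) {f : ℕ → Mat q}
    (h : (hankel n f).PosSemidef) : (f (2 * k)).PosSemidef := by
  have h' := h.submatrix fun a : Fin q => ((⟨k, by omega⟩ : Fin (n + 1)), a)
  rw [two_mul]
  exact h'

theorem hankel_add (n : ℕ) (f g : ℕ → Mat q) : hankel n f + hankel n g = hankel n (f + g) := rfl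

theorem smul_hankel (n : ℕ) (c : ℂ) (f : ℕ → Mat q) : c • hankel n f = hankel n (c • f) := rfl

/-- Multiplying a moment sequence by the square `(x - γ) ^ 2` of a real linear polynomial preserves
non-negativity of the block Hankel matrices. -/
theorem posSemidef_hankel_seqA_seqA {n : ℕ} (γ : ℝ) {f : ℕ → Mat q}
    (h : (hankel (n + 1) f).PosSemidef) : (hankel n (seqA γ (seqA γ f))).PosSemidef := by
  -- Compression of the larger Hankel matrix by the block matrix of `p(x) ↦ (x - γ) p(x)`.
  let e₀ : Fin (n + 1) × Fin q → Fin (n + 1 + 1) × Fin q := fun x => (x.1.castSucc, x.2)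
  let e₁ : Fin (n + 1) × Fin q → Fin (n + 1 + 1) × Fin q := fun x => (x.1.succ, x.2)
  let E₀ : Matrix (Fin (n + 1 + 1) × Fin q) (Fin (n + 1) × Fin q) ℂ :=
    (1 : BMat (n + 1) q).submatrix (Equiv.refl _) e₀
  let E₁ : Matrix (Fin (n + 1 + 1) × Fin q) (Fin (n + 1) × Fin q) ℂ :=
    (1 : BMat (n + 1) q).submatrix (Equiv.refl _) e₁
  have key : ∀ e e' : Fin (n + 1) × Fin q → Fin (n + 1 + 1) × Fin q,
      ((1 : BMat (n + 1) q).submatrix (Equiv.refl _) e)ᴴ * (hankel (n + 1) f *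
        (1 : BMat (n + 1) q).submatrix (Equiv.refl _) e') = (hankel (n + 1) f).submatrix e e' := by
    intro e e'
    rw [mul_submatrix_one, conjTranspose_submatrix, conjTranspose_one, one_submatrix_mul]
    rfl
  convert h.conjTranspose_mul_mul_same (E₁ - (γ : ℂ) • E₀) using 1
  rw [Matrix.mul_assoc, Matrix.mul_sub, conjTranspose_sub, conjTranspose_smul, Matrix.sub_mul,
    Matrix.mul_sub, Matrix.mul_sub, Matrix.mul_smul, Matrix.mul_smul, Matrix.smul_mul,
    Matrix.smul_mul, Matrix.mul_smul, key, key, key, key]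
  ext ⟨j, a⟩ ⟨k, b⟩
  have e1 : (k : ℕ) + 1 + j = j + k + 1 := by omega
  have e2 : (j : ℕ) + 1 + (k + 1) = j + k + 1 + 1 := by omega
  have e3 : (j : ℕ) + 1 + k = j + k + 1 := by omega
  have e4 : (j : ℕ) + (k + 1) = j + k + 1 := by omega
  simp only [hankel, blockMat, of_apply, seqA, Matrix.add_apply, Matrix.neg_apply,
    Matrix.smul_apply, Matrix.sub_apply, submatrix_apply, e₀, e₁, Fin.val_succ, Fin.val_castSucc,
    smul_eq_mul, Complex.star_def, Complex.conj_ofReal, e2, e3, e4]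
  ring

theorem seqB_seqB (β : ℝ) (f : ℕ → Mat q) : seqB β (seqB β f) = seqA β (seqA β f) := by
  funext j
  simp only [seqA, seqB]
  module

theorem seqA_comm (γ δ : ℝ) (f : ℕ → Mat q) : seqA γ (seqA δ f) = seqA δ (seqA γ f) := by
  funext j
  simp only [seqA]
  module

theorem seqA_seqB_comm (γ δ : ℝ) (f : ℕ → Mat q) : seqA γ (seqB δ f) = seqB δ (seqA γ f) := by
  funext j
  simp only [seqA, seqB]
  module

theorem seqA_add_seqB (α β : ℝ) (f : ℕ → Mat q) :
    seqA α f + seqB β f = ((β - α : ℝ) : ℂ) • f := by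
  funext j
  simp only [seqA, seqB, Pi.add_apply, Pi.smul_apply]
  push_cast
  module

theorem posSemidef_hankel_of_add {n : ℕ} {α β : ℝ} (hαβ : α < β) {f : ℕ → Mat q}
    (hA : (hankel n (seqA α f)).PosSemidef) (hB : (hankel n (seqB β f)).PosSemidef) :
    (hankel n f).PosSemidef := by
  have hδ : (0 : ℝ) < β - α := sub_pos.2 hαβ
  have h := (hA.add hB).smul (α := ℂ) (a := (((β - α)⁻¹ : ℝ) : ℂ))
    (by exact_mod_cast (inv_pos.2 hδ).le)
  rwa [hankel_add, seqA_add_seqB, smul_hankel, smul_smul, ← Complex.ofReal_mul,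
    inv_mul_cancel₀ hδ.ne', Complex.ofReal_one, one_smul] at h

/-- For `α < β`, dropping the last term of a non-negative definite sequence leaves a non-negative
definite one: for `κ` even this uses `(β - α) (x - α) = (x - α) ^ 2 + (β - x) (x - α)` and its
mirror image, for `κ` odd `(β - α) = (x - α) + (β - x)`. -/
theorem IsNonnegDef.of_succ {α β : ℝ} (hαβ : α < β) {κ : ℕ} {s : ℕ → Mat q}
    (h : IsNonnegDef α β (κ + 1) s) : IsNonnegDef α β κ s := by
  obtain ⟨h₁, h₂, h₃⟩ := h
  refine ⟨fun n hn => ?_, fun n hn => ?_, fun n hn => ?_⟩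
  · obtain ⟨hA, hB⟩ := h₃ n (by omega)
    exact posSemidef_hankel_of_add hαβ hA hB
  · obtain ⟨hA, hB⟩ := h₃ (n + 1) (by omega)
    apply posSemidef_hankel_of_add hαβ
    · rw [seqAB_eq, seqA_seqB_comm, seqA_comm, ← seqA_seqB_comm, ← seqA_seqB_comm]
      exact posSemidef_hankel_seqA_seqA α hB
    · rw [seqAB_eq, seqB_seqB]
      exact posSemidef_hankel_seqA_seqA β hA
  · have hs := h₁ (n + 1) (by omega)
    have hc := h₂ n (by omega)
    constructor
    · apply posSemidef_hankel_of_add hαβ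
      · exact posSemidef_hankel_seqA_seqA α hs
      · rwa [← seqAB_eq]
    · apply posSemidef_hankel_of_add hαβ
      · rwa [seqA_seqB_comm, ← seqAB_eq]
      · rw [seqB_seqB]
        exact posSemidef_hankel_seqA_seqA β hs

/-- If `s` is non-negative definite on `[α, β]`, so is the sequence of moments of `x - α`
times the underlying measure. -/
theorem IsNonnegDef.isNonnegDef_seqA {α β : ℝ} {κ : ℕ} {s : ℕ → Mat q}
    (h : IsNonnegDef α β (κ + 1) s) : IsNonnegDef α β κ (seqA α s) := by
  obtain ⟨h₁, h₂, h₃⟩ := h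
  refine ⟨fun n hn => (h₃ n (by omega)).1, fun n hn => ?_, fun n hn => ⟨?_, ?_⟩⟩
  · rw [seqAB_eq, ← seqA_seqB_comm, ← seqA_seqB_comm]
    exact posSemidef_hankel_seqA_seqA α (h₃ (n + 1) (by omega)).2
  · exact posSemidef_hankel_seqA_seqA α (h₁ (n + 1) (by omega))
  · rw [← seqAB_eq]
    exact h₂ n (by omega)

theorem mulVec_eq_zero_of_add {A B : Mat q} (hA : A.PosSemidef) (hB : B.PosSemidef)
    {v : Fin q → ℂ} (h : (A + B) *ᵥ v = 0) : A *ᵥ v = 0 := by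
  rw [← hA.dotProduct_mulVec_zero_iff]
  have hsum : star v ⬝ᵥ (A *ᵥ v) + star v ⬝ᵥ (B *ᵥ v) = 0 := by
    rw [← dotProduct_add, ← add_mulVec, h, dotProduct_zero]
  exact ((add_eq_zero_iff_of_nonneg (hA.dotProduct_mulVec_nonneg v)
    (hB.dotProduct_mulVec_nonneg v)).1 hsum).1

/-- All terms of a non-negative definite sequence are Hermitian and their kernels contain the kernel
of the first term. -/
theorem IsNonnegDef.isHermitian_and_mulVec_eq_zero {α β : ℝ} (hαβ : α < β) {κ : ℕ}
    {s : ℕ → Mat q} (h : IsNonnegDef α β κ s) : ∀ j ≤ κ, (s j)ᴴ = s j ∧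
      ∀ v : Fin q → ℂ, s 0 *ᵥ v = 0 → s j *ᵥ v = 0 := by
  induction κ with
  | zero =>
    intro j hj
    obtain rfl : j = 0 := by omega
    exact ⟨(posSemidef_of_hankel le_rfl (h.1 0 rfl)).isHermitian, fun v hv => hv⟩
  | succ κ ih =>
    have ih := ih (h.of_succ hαβ)
    intro j hj
    rcases Nat.lt_or_eq_of_le hj with hj | rfl
    · exact ih j (by omega)
    obtain ⟨m, hm | hm⟩ : ∃ m, κ = 2 * m ∨ κ = 2 * m + 1 := ⟨κ / 2, by omega⟩
    · subst hm
      -- Odd index: `a_{2m}` and `b_{2m}` are non-negative with sum `(β - α) s_{2m}`.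
      obtain ⟨hA, hB⟩ := h.2.2 m rfl
      have hA := posSemidef_of_hankel le_rfl hA
      have hB := posSemidef_of_hankel le_rfl hB
      obtain ⟨hsH, hsv⟩ := ih (2 * m) le_rfl
      have hs : s (2 * m + 1) = seqA α s (2 * m) + (α : ℂ) • s (2 * m) := by
        simp only [seqA]
        abel
      refine ⟨?_, fun v hv => ?_⟩
      · rw [hs, conjTranspose_add, conjTranspose_smul, hsH, hA.isHermitian.eq, Complex.star_def,
          Complex.conj_ofReal]
      · rw [hs, add_mulVec, smul_mulVec, hsv v hv, smul_zero, add_zero]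
        apply mulVec_eq_zero_of_add hA hB
        have := congrFun (seqA_add_seqB α β s) (2 * m)
        simp only [Pi.add_apply, Pi.smul_apply] at this
        rw [this, smul_mulVec, hsv v hv, smul_zero]
    · subst hm
      -- Even index: `s_{2m+2}` and `c_{2m}` are non-negative and their sum involves only earlier
      -- terms.
      have hS := posSemidef_of_hankel le_rfl (h.1 (m + 1) (by omega))
      have hC := posSemidef_of_hankel le_rfl (h.2.1 m (by omega))
      refine ⟨hS.isHermitian, fun v hv => ?_⟩
      apply mulVec_eq_zero_of_add hS hC
      have hs : s (2 * (m + 1)) + seqAB α β s (2 * m) =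
          -(((α : ℂ) * β) • s (2 * m)) + ((α : ℂ) + β) • s (2 * m + 1) := by
        simp only [seqAB, show 2 * (m + 1) = 2 * m + 2 by ring]
        abel
      rw [hs, add_mulVec, neg_mulVec, smul_mulVec, smul_mulVec, (ih (2 * m) (by omega)).2 v hv,
        (ih (2 * m + 1) (by omega)).2 v hv, smul_zero, smul_zero, neg_zero, add_zero]

theorem IsNonnegDef.isHermitian {α β : ℝ} (hαβ : α < β) {κ : ℕ} {s : ℕ → Mat q}
    (h : IsNonnegDef α β κ s) {j : ℕ} (hj : j ≤ κ) : (s j)ᴴ = s j :=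
  (h.isHermitian_and_mulVec_eq_zero hαβ j hj).1

theorem IsNonnegDef.proj_mul {α β : ℝ} (hαβ : α < β) {κ : ℕ} {s : ℕ → Mat q}
    (h : IsNonnegDef α β κ s) {j : ℕ} (hj : j ≤ κ) : s 0 * mpInv (s 0) * s j = s j := by
  have h0 := h.isHermitian hαβ (Nat.zero_le κ)
  have hz : s j * (1 - mpInv (s 0) * s 0) = 0 := by
    apply Matrix.ext_of_mulVec_single
    intro i
    rw [← mulVec_mulVec, zero_mulVec]
    apply (h.isHermitian_and_mulVec_eq_zero hαβ j hj).2
    rw [mulVec_mulVec, mul_sub, mul_one, ← mul_assoc, (mpInv_spec (s 0)).mul_mul_left, sub_self,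
      zero_mulVec]
  rw [mul_sub, mul_one, sub_eq_zero] at hz
  have hz' := congrArg conjTranspose hz
  rw [conjTranspose_mul, h.isHermitian hαβ hj, (mpInv_spec (s 0)).herm_right,
    ← mul_mpInv_comm h0] at hz'
  exact hz'.symm

end

/-! ### The factorizations for dominated sequences -/

section
variable {n q : ℕ} {α β : ℝ} {s : ℕ → Mat q}

theorem coeff_zero_mul_eq_one {F G : PowerSeries (Mat q)} (hF : PowerSeries.coeff 0 F = 1)
    (hG : PowerSeries.coeff 0 G = 1) : PowerSeries.coeff 0 (F * G) = 1 := by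
  rw [PowerSeries.coeff_zero_eq_constantCoeff_apply] at *
  rw [map_mul, hF, hG, one_mul]

theorem Dominated.hankel_seqA_schurTransform (n : ℕ) (hαβ : α < β) (hs : Dominated s)
    (ha : Dominated (seqA α s)) :
    hankel n (seqA α (schurTransform α β s)) =
        ((β - α : ℝ) : ℂ) • (resolv n q β * repDiag n (seqA α s 0) *
          mpInv (toepL n (seqA α s)) * hankel n (seqAB α β s) * mpInv (toepU n (seqA α s)) *
          repDiag n (seqA α s 0) * (resolv n q β)ᴴ) ∧
      hankel n (seqA α (schurTransform α β s)) =
        ((β - α : ℝ) : ℂ) • (resolv n q β * facL n (seqA α s) * hankel n (seqAB α β s) *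
          facU n (seqA α s) * (resolv n q β)ᴴ) ∧
      (hankel n (seqA α (schurTransform α β s))).rank = (hankel n (seqAB α β s)).rank ∧
      (hankel n (seqA α (schurTransform α β s))).det =
        ((β - α : ℝ) : ℂ) ^ ((n + 1) * q) * (hankel n (seqAB α β s)).det ∧
      LDUEquiv (hankel n (seqA α (schurTransform α β s)))
        (((β - α : ℝ) : ℂ) • hankel n (seqAB α β s)) := by
  have hδ : ((β - α : ℝ) : ℂ) ≠ 0 := by exact_mod_cast (sub_pos.2 hαβ).ne'
  have h := hankel_seqA_eq (n := n) β hs ha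
  have hD : facL n (seqA α s) * hankel n (seqAB α β s) =
      repDiag n (seqA α s 0) * toepL n (recip (seqA α s)) * hankel n (seqAB α β s) :=
    facL_mul_of_proj_mul fun j k => ha.seqA_proj_mul_seqAB β (j + k)
  have h' := h
  rw [congruence_eq_of_mul_eq hD (hankel_conjTranspose (ha.seqAB_herm β))] at h'
  refine ⟨?_, ?_, ?_⟩
  · rw [h, conjTranspose_mul, repDiag_conjTranspose, ha.herm, ha.mpInv_toepL, ha.mpInv_toepU]
    simp only [Matrix.mul_assoc]
  · rw [h', ha.facU_eq]
    simp only [Matrix.mul_assoc]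
  · obtain ⟨G, hG, -, hR⟩ := exists_serToepL_eq_resolv n (q := q) β
    refine congruence_serToepL (F := G * (PowerSeries.C (seqA α s 0) *
      PowerSeries.mk (recip (seqA α s)) +
        PowerSeries.C (1 - seqA α s 0 * mpInv (seqA α s 0)))) ?_ hδ ?_
    · exact coeff_zero_mul_eq_one hG (coeff_zero_facL _)
    · rw [h', serToepL_mul, ← facL_eq, ← hR, conjTranspose_mul]
      simp only [Matrix.mul_assoc]

theorem Dominated.hankel_seqB_schurTransform (n : ℕ) (hαβ : α < β) (hs : Dominated s)
    (ha : Dominated (seqA α s)) :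
    hankel n (seqB β (schurTransform α β s)) =
        ((β - α : ℝ) : ℂ) • (repDiag n (seqA α s 0) * mpInv (toepL n (seqA α s)) *
          schurHankelSucc n s * mpInv (toepU n (seqA α s)) * repDiag n (seqA α s 0)) ∧
      hankel n (seqB β (schurTransform α β s)) =
        ((β - α : ℝ) : ℂ) • (facL₂ n (seqA α s) s * facL n s * schurHankelSucc n s *
          facU n s * facU₂ n (seqA α s) s) ∧
      (hankel n (seqB β (schurTransform α β s))).rank = (schurHankelSucc n s).rank ∧
      (hankel n (seqB β (schurTransform α β s))).det =
        ((β - α : ℝ) : ℂ) ^ ((n + 1) * q) * (schurHankelSucc n s).det ∧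
      LDUEquiv (hankel n (seqB β (schurTransform α β s)))
        (((β - α : ℝ) : ℂ) • schurHankelSucc n s) := by
  have hδ : ((β - α : ℝ) : ℂ) ≠ 0 := by exact_mod_cast (sub_pos.2 hαβ).ne'
  have h := hankel_seqB_eq (n := n) β hs ha
  have h' := h
  rw [congruence_eq_of_mul_eq (facL₂_mul_facL_mul_schurHankelSucc hs ha)
    (schurHankelSucc_conjTranspose hs.herm)] at h'
  refine ⟨?_, ?_, ?_⟩
  · rw [h, conjTranspose_mul, repDiag_conjTranspose, ha.herm, ha.mpInv_toepL, ha.mpInv_toepU]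
    simp only [Matrix.mul_assoc]
  · rw [h', hs.facU_eq, facU₂_eq ha hs, conjTranspose_mul]
    simp only [Matrix.mul_assoc]
  · rw [facL₂_eq, facL_eq, ← serToepL_mul] at h'
    exact congruence_serToepL (coeff_zero_mul_eq_one (coeff_zero_facL₂ _ _) (coeff_zero_facL _))
      hδ h'

theorem Dominated.hankel_seqAB_schurTransform (n : ℕ) (hαβ : α < β) (hs : Dominated s)
    (ha : Dominated (seqA α s)) :
    hankel n (seqAB α β (schurTransform α β s)) =
        ((β - α : ℝ) : ℂ) • (repDiag n (seqA α s 0) * mpInv (toepL n (seqA α s)) *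
          schurHankelSucc n (seqA α s) * mpInv (toepU n (seqA α s)) *
          repDiag n (seqA α s 0)) ∧
      hankel n (seqAB α β (schurTransform α β s)) =
        ((β - α : ℝ) : ℂ) • (facL n (seqA α s) * schurHankelSucc n (seqA α s) *
          facU n (seqA α s)) ∧
      (hankel n (seqAB α β (schurTransform α β s))).rank =
        (schurHankelSucc n (seqA α s)).rank ∧
      (hankel n (seqAB α β (schurTransform α β s))).det =
        ((β - α : ℝ) : ℂ) ^ ((n + 1) * q) * (schurHankelSucc n (seqA α s)).det ∧
      LDUEquiv (hankel n (seqAB α β (schurTransform α β s)))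
        (((β - α : ℝ) : ℂ) • schurHankelSucc n (seqA α s)) := by
  have hδ : ((β - α : ℝ) : ℂ) ≠ 0 := by exact_mod_cast (sub_pos.2 hαβ).ne'
  have h := hankel_seqAB_eq (n := n) β hs ha
  have hD : facL n (seqA α s) * schurHankelSucc n (seqA α s) =
      repDiag n (seqA α s 0) * toepL n (recip (seqA α s)) * schurHankelSucc n (seqA α s) := by
    rw [schurHankelSucc_eq]
    exact facL_mul_of_proj_mul ha.proj_mul_schur
  have h' := h
  rw [congruence_eq_of_mul_eq hD (schurHankelSucc_conjTranspose ha.herm)] at h'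
  refine ⟨?_, ?_, ?_⟩
  · rw [h, conjTranspose_mul, repDiag_conjTranspose, ha.herm, ha.mpInv_toepL, ha.mpInv_toepU]
    simp only [Matrix.mul_assoc]
  · rw [h', ha.facU_eq]
  · rw [facL_eq] at h'
    exact congruence_serToepL (coeff_zero_facL _) hδ h'

end

/-! ### Passage from finite to infinite sequences -/

section Congruence
variable {n q : ℕ} {f g s s' : ℕ → Mat q}

theorem hankel_congr (h : ∀ j ≤ 2 * n, f j = g j) : hankel n f = hankel n g :=
  blockMat_congr fun j hj k hk => h (j + k) (by omega)

theorem toepL_congr (h : ∀ j ≤ n, f j = g j) : toepL n f = toepL n g :=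
  blockMat_congr fun j hj k hk => by rw [h (j - k) (by omega)]

theorem toepU_congr (h : ∀ j ≤ n, f j = g j) : toepU n f = toepU n g :=
  blockMat_congr fun j hj k hk => by rw [h (k - j) (by omega)]

theorem recip_congr {j : ℕ} (h : ∀ l ≤ j, f l = g l) : recip f j = recip g j := by
  induction j using Nat.strong_induction_on with
  | _ j ih =>
    cases j with
    | zero => rw [recip_zero, recip_zero, h 0 le_rfl]
    | succ j =>
      rw [recip_succ, recip_succ, h 0 (Nat.zero_le _)]
      congr 2
      refine Finset.sum_congr rfl fun l hl => ?_
      rw [Finset.mem_range] at hl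
      rw [h (j + 1 - l) (by omega), ih l hl fun i hi => h i (by omega)]

theorem facL_congr (h : ∀ j ≤ n, f j = g j) : facL n f = facL n g := by
  rw [facL, facL, h 0 (Nat.zero_le _),
    toepL_congr fun j hj => recip_congr fun l hl => h l (hl.trans hj)]

theorem facU_congr (h : ∀ j ≤ n, f j = g j) : facU n f = facU n g := by
  rw [facU, facU, h 0 (Nat.zero_le _),
    toepU_congr fun j hj => recip_congr fun l hl => h l (hl.trans hj)]

theorem facL₂_congr (h : ∀ j ≤ n, f j = g j) (h' : ∀ j ≤ n, s j = s' j) :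
    facL₂ n f s = facL₂ n g s' := by
  rw [facL₂, facL₂, h 0 (Nat.zero_le _), h' 0 (Nat.zero_le _), toepL_congr h',
    toepL_congr fun j hj => recip_congr fun l hl => h l (hl.trans hj)]

theorem facU₂_congr (h : ∀ j ≤ n, f j = g j) (h' : ∀ j ≤ n, s j = s' j) :
    facU₂ n f s = facU₂ n g s' := by
  rw [facU₂, facU₂, h 0 (Nat.zero_le _), h' 0 (Nat.zero_le _), toepU_congr h',
    toepU_congr fun j hj => recip_congr fun l hl => h l (hl.trans hj)]

theorem schurHankelSucc_congr (h : ∀ j ≤ 2 * n + 2, f j = g j) :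
    schurHankelSucc n f = schurHankelSucc n g := by
  rw [schurHankelSucc_eq, schurHankelSucc_eq]
  refine blockMat_congr fun j hj k hk => ?_
  rw [h 0 (by omega), h (j + 1) (by omega), h (k + 1) (by omega), h (j + 1 + (k + 1)) (by omega)]

theorem seqA_congr (α : ℝ) {j : ℕ} (h : f j = g j) (h' : f (j + 1) = g (j + 1)) :
    seqA α f j = seqA α g j := by rw [seqA, seqA, h, h']

theorem seqB_congr (β : ℝ) {j : ℕ} (h : f j = g j) (h' : f (j + 1) = g (j + 1)) :
    seqB β f j = seqB β g j := by rw [seqB, seqB, h, h']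

theorem seqAB_congr (α β : ℝ) {j : ℕ} (h : ∀ l ≤ j + 2, f l = g l) :
    seqAB α β f j = seqAB α β g j := by
  rw [seqAB, seqAB, h j (by omega), h (j + 1) (by omega), h (j + 2) (by omega)]

theorem schurTransform_congr (α β : ℝ) {j : ℕ} (h : ∀ l ≤ j + 1, s l = s' l) :
    schurTransform α β s j = schurTransform α β s' j := by
  have ha : ∀ l ≤ j, seqA α s l = seqA α s' l := fun l hl =>
    seqA_congr α (h l (by omega)) (h (l + 1) (by omega))
  have hm : ∀ l ≤ j, modB β (seqA α s) l = modB β (seqA α s') l := by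
    intro l hl
    cases l with
    | zero => rw [modB, modB, ha 0 hl]
    | succ l => exact seqB_congr β (ha l (by omega)) (ha (l + 1) hl)
  have hc : cauchyProd (seqB β s) (recip (modB β (seqA α s))) j =
      cauchyProd (seqB β s') (recip (modB β (seqA α s'))) j := by
    refine Finset.sum_congr rfl fun l hl => ?_
    rw [Finset.mem_range] at hl
    rw [seqB_congr β (h l (by omega)) (h (l + 1) (by omega)),
      recip_congr fun i hi => hm i (by omega)]
  rw [schurTransform, schurTransform, ha 0 (by omega), h 0 (by omega), hc]

end Congruence

/-- The extension of `s_0, …, s_κ` to all indices as a geometric sequence of ratio `α`, so that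
`a_j = 0` for `j ≥ κ`. -/
noncomputable def geomExtend (α : ℝ) (κ : ℕ) {q : ℕ} (s : ℕ → Mat q) : ℕ → Mat q :=
  fun j => if j ≤ κ then s j else (α : ℂ) ^ (j - κ) • s κ

section Extension
variable {q : ℕ} {α β : ℝ} {κ : ℕ} {s : ℕ → Mat q}

theorem geomExtend_of_le {j : ℕ} (h : j ≤ κ) : geomExtend α κ s j = s j := if_pos h

theorem seqA_geomExtend_of_lt {j : ℕ} (h : j < κ) :
    seqA α (geomExtend α κ s) j = seqA α s j :=
  seqA_congr α (geomExtend_of_le h.le) (geomExtend_of_le h)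

theorem seqA_geomExtend_of_le {j : ℕ} (h : κ ≤ j) : seqA α (geomExtend α κ s) j = 0 := by
  have hj : ∀ i, κ ≤ i → geomExtend α κ s i = (α : ℂ) ^ (i - κ) • s κ := by
    intro i hi
    rcases hi.eq_or_lt with rfl | hi
    · simp [geomExtend]
    · exact if_neg (by omega)
  rw [seqA, hj j h, hj (j + 1) (by omega), show j + 1 - κ = j - κ + 1 by omega, pow_succ',
    mul_smul, neg_add_cancel]

theorem IsNonnegDef.dominated_geomExtend (hαβ : α < β) (h : IsNonnegDef α β κ s) :
    Dominated (geomExtend α κ s) := by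
  constructor <;> intro j <;> rcases le_or_gt j κ with hj | hj
  · rw [geomExtend_of_le hj, h.isHermitian hαβ hj]
  · rw [geomExtend, if_neg (by omega), conjTranspose_smul, h.isHermitian hαβ le_rfl,
      Complex.star_def, map_pow, Complex.conj_ofReal]
  · rw [geomExtend_of_le hj, geomExtend_of_le (Nat.zero_le _), h.proj_mul hαβ hj]
  · rw [geomExtend_of_le (Nat.zero_le _), geomExtend, if_neg (by omega), mul_smul_comm,
      h.proj_mul hαβ le_rfl]

theorem IsNonnegDef.dominated_seqA_geomExtend (hαβ : α < β) (h : IsNonnegDef α β (κ + 1) s) :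
    Dominated (seqA α (geomExtend α (κ + 1) s)) := by
  have ha := h.isNonnegDef_seqA
  constructor <;> intro j <;> rcases Nat.lt_or_ge j (κ + 1) with hj | hj
  · rw [seqA_geomExtend_of_lt hj, ha.isHermitian hαβ (Nat.lt_succ_iff.1 hj)]
  · rw [seqA_geomExtend_of_le hj, conjTranspose_zero]
  · rw [seqA_geomExtend_of_lt hj, seqA_geomExtend_of_lt (Nat.succ_pos κ),
      ha.proj_mul hαβ (Nat.lt_succ_iff.1 hj)]
  · rw [seqA_geomExtend_of_le hj, mul_zero]

end Extension

end HausdorffMoment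

open HausdorffMoment in
open scoped Matrix in
theorem propositionF (q : ℕ) (hq : 1 ≤ q) (α β : ℝ) (hαβ : α < β) (n : ℕ) (s : ℕ → Mat q) :
    -- the matrix built from `u_j = -α t_j + t_{j+1}`
    (IsNonnegDef α β (2 * n + 2) s →
      hankel n (seqA α (schurTransform α β s)) =
          ((β - α : ℝ) : ℂ) • (resolv n q β * repDiag n (seqA α s 0) *
            mpInv (toepL n (seqA α s)) * hankel n (seqAB α β s) * mpInv (toepU n (seqA α s)) *
            repDiag n (seqA α s 0) * (resolv n q β)ᴴ) ∧
        hankel n (seqA α (schurTransform α β s)) =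
          ((β - α : ℝ) : ℂ) • (resolv n q β * facL n (seqA α s) * hankel n (seqAB α β s) *
            facU n (seqA α s) * (resolv n q β)ᴴ) ∧
        (hankel n (seqA α (schurTransform α β s))).rank = (hankel n (seqAB α β s)).rank ∧
        (hankel n (seqA α (schurTransform α β s))).det =
          ((β - α : ℝ) : ℂ) ^ ((n + 1) * q) * (hankel n (seqAB α β s)).det ∧
        LDUEquiv (hankel n (seqA α (schurTransform α β s)))
          (((β - α : ℝ) : ℂ) • hankel n (seqAB α β s))) ∧
    -- the matrix built from `v_j = β t_j - t_{j+1}`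
    (IsNonnegDef α β (2 * n + 2) s →
      hankel n (seqB β (schurTransform α β s)) =
          ((β - α : ℝ) : ℂ) • (repDiag n (seqA α s 0) * mpInv (toepL n (seqA α s)) *
            schurHankelSucc n s * mpInv (toepU n (seqA α s)) * repDiag n (seqA α s 0)) ∧
        hankel n (seqB β (schurTransform α β s)) =
          ((β - α : ℝ) : ℂ) • (facL₂ n (seqA α s) s * facL n s * schurHankelSucc n s *
            facU n s * facU₂ n (seqA α s) s) ∧
        (hankel n (seqB β (schurTransform α β s))).rank = (schurHankelSucc n s).rank ∧
        (hankel n (seqB β (schurTransform α β s))).det =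
          ((β - α : ℝ) : ℂ) ^ ((n + 1) * q) * (schurHankelSucc n s).det ∧
        LDUEquiv (hankel n (seqB β (schurTransform α β s)))
          (((β - α : ℝ) : ℂ) • schurHankelSucc n s)) ∧
    -- the matrix built from `w_j = -α β t_j + (α + β) t_{j+1} - t_{j+2}`
    (IsNonnegDef α β (2 * n + 3) s →
      hankel n (seqAB α β (schurTransform α β s)) =
          ((β - α : ℝ) : ℂ) • (repDiag n (seqA α s 0) * mpInv (toepL n (seqA α s)) *
            schurHankelSucc n (seqA α s) * mpInv (toepU n (seqA α s)) *
            repDiag n (seqA α s 0)) ∧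
        hankel n (seqAB α β (schurTransform α β s)) =
          ((β - α : ℝ) : ℂ) • (facL n (seqA α s) * schurHankelSucc n (seqA α s) *
            facU n (seqA α s)) ∧
        (hankel n (seqAB α β (schurTransform α β s))).rank =
          (schurHankelSucc n (seqA α s)).rank ∧
        (hankel n (seqAB α β (schurTransform α β s))).det =
          ((β - α : ℝ) : ℂ) ^ ((n + 1) * q) * (schurHankelSucc n (seqA α s)).det ∧
        LDUEquiv (hankel n (seqAB α β (schurTransform α β s)))
          (((β - α : ℝ) : ℂ) • schurHankelSucc n (seqA α s))) := by
  have hcongr : ∀ κ, ∀ j ≤ κ, s j = geomExtend α κ s j := fun κ j hj =>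
    (geomExtend_of_le hj).symm
  refine ⟨fun h => ?_, fun h => ?_, fun h => ?_⟩
  · have hs := h.dominated_geomExtend hαβ
    have ha := IsNonnegDef.dominated_seqA_geomExtend hαβ h
    have he := hcongr (2 * n + 2)
    set s' := geomExtend α (2 * n + 2) s
    have hA : ∀ j ≤ n, seqA α s j = seqA α s' j := fun j hj =>
      seqA_congr α (he j (by omega)) (he (j + 1) (by omega))
    have hT : ∀ j ≤ 2 * n + 1, schurTransform α β s j = schurTransform α β s' j := fun j hj =>
      schurTransform_congr α β fun l hl => he l (by omega)
    have hU : hankel n (seqA α (schurTransform α β s)) =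
        hankel n (seqA α (schurTransform α β s')) :=
      hankel_congr fun j hj => seqA_congr α (hT j (by omega)) (hT (j + 1) (by omega))
    have hC : hankel n (seqAB α β s) = hankel n (seqAB α β s') :=
      hankel_congr fun j hj => seqAB_congr α β fun l hl => he l (by omega)
    rw [hU, hC, hA 0 (Nat.zero_le n), toepL_congr hA, toepU_congr hA, facL_congr hA, facU_congr hA]
    exact hs.hankel_seqA_schurTransform n hαβ ha
  · have hs := h.dominated_geomExtend hαβ
    have ha := IsNonnegDef.dominated_seqA_geomExtend hαβ h
    have he := hcongr (2 * n + 2)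
    set s' := geomExtend α (2 * n + 2) s
    have hS : ∀ j ≤ n, s j = s' j := fun j hj => he j (by omega)
    have hA : ∀ j ≤ n, seqA α s j = seqA α s' j := fun j hj =>
      seqA_congr α (he j (by omega)) (he (j + 1) (by omega))
    have hT : ∀ j ≤ 2 * n + 1, schurTransform α β s j = schurTransform α β s' j := fun j hj =>
      schurTransform_congr α β fun l hl => he l (by omega)
    have hV : hankel n (seqB β (schurTransform α β s)) =
        hankel n (seqB β (schurTransform α β s')) :=
      hankel_congr fun j hj => seqB_congr β (hT j (by omega)) (hT (j + 1) (by omega))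
    rw [hV, schurHankelSucc_congr he, hA 0 (Nat.zero_le n), toepL_congr hA, toepU_congr hA,
      facL_congr hS, facU_congr hS, facL₂_congr hA hS, facU₂_congr hA hS]
    exact hs.hankel_seqB_schurTransform n hαβ ha
  · have hs := h.dominated_geomExtend hαβ
    have ha := IsNonnegDef.dominated_seqA_geomExtend hαβ h
    have he := hcongr (2 * n + 3)
    set s' := geomExtend α (2 * n + 3) s
    have hA : ∀ j ≤ 2 * n + 2, seqA α s j = seqA α s' j := fun j hj =>
      seqA_congr α (he j (by omega)) (he (j + 1) (by omega))
    have hA' : ∀ j ≤ n, seqA α s j = seqA α s' j := fun j hj => hA j (by omega)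
    have hW : hankel n (seqAB α β (schurTransform α β s)) =
        hankel n (seqAB α β (schurTransform α β s')) :=
      hankel_congr fun j hj => seqAB_congr α β fun l hl =>
        schurTransform_congr α β fun i hi => he i (by omega)
    rw [hW, schurHankelSucc_congr hA, hA 0 (Nat.zero_le _), toepL_congr hA', toepU_congr hA',
      facL_congr hA', facU_congr hA']
    exact hs.hankel_seqAB_schurTransform n hαβ ha
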